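/- Let $d$ be a dimension. For a finite nonempty set $A\subseteq\mathbb R^d$ write $\delta_A=\frac1{\#A}\sum_{a\in A}\delta_a$. An *admissible pair* in $\mathbb R^d$ is a pair $(R,B)$, where $R\in M_d(\mathbb Z)$ has all its eigenvalues of modulus strictly greater than $1$ and $B\subseteq\mathbb Z^d$ is a finite nonempty set, such that for some finite $L\subseteq\mathbb Z^d$ with $\#L=\#B$ the matrix $\big[\tfrac1{\sqrt{\#B}}e^{-2\pi i (R^{-1}b)\cdot\ell}\big]_{b\in B,\ \ell\in L}$ is unitary. Let $\{(R_n,B_n)\}_{n=1}^\infty$ be a sequence of admissible pairs in $\mathbb R^d$. Suppose that (i) $\lim_{n\to\infty}\|R_1^{-1}R_2^{-1}\cdots R_n^{-1}\|=0$ (operator norm for the Euclidean norm), and that there is a cube $C=t_0+[0,1]^d$, $t_0\in\mathbb R^d$, such that (ii) $R_n^{-1}(C+b)\subseteq C$ for every $n\ge1$ and every $b\in B_n$; (iii) there is an admissible pair $(R,B)$ with $(R_n,B_n)=(R,B)$ for infinitely many $n$, and $R^{-1}(C+b_0)\subseteq\operatorname{int}(C)$ for some $b_0\in B$. Then the infinite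 convolution $$\mu=\delta_{R_1^{-1}B_1}*\delta_{(R_2R_1)^{-1}B_2}*\cdots*\delta_{(R_n\cdots R_2R_1)^{-1}B_n}*\cdots$$ exists, i.e. the finite convolutions $\mu_n=\delta_{R_1^{-1}B_1}*\cdots*\delta_{(R_n\cdots R_1)^{-1}B_n}$ converge weakly to a Borel probability measure $\mu$ on $\mathbb R^d$, and $\mu$ is a spectral measure with a spectrum in $\mathbb Z^d$: there is a (countable) set $\Lambda\subseteq\mathbb Z^d$ such that the family $\{e^{2\pi i\lambda\cdot x}\}_{\lambda\in\Lambda}$ is an orthonormal basis of $L^2(\mu)$. -/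

import Mathlib

open MeasureTheory Filter Topology

noncomputable section

namespace SpectralConv

/-- `ℝ^d` with its Euclidean norm and standard inner product. -/
abbrev E (d : ℕ) : Type := EuclideanSpace ℝ (Fin d)

/-- An integral vector, seen in `ℝ^d`. -/
def intVec {d : ℕ} (b : Fin d → ℤ) : E d := WithLp.toLp 2 (fun i => (b i : ℝ))

/-- An integral matrix, seen as a real matrix. -/
def realMat {d : ℕ} (R : Matrix (Fin d) (Fin d) ℤ) : Matrix (Fin d) (Fin d) ℝ :=
  R.map (Int.cast : ℤ → ℝ)

/-- The linear map `x ↦ M x` of `ℝ^d`; its norm is the operator norm `‖M‖` of `M` with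
respect to the Euclidean norm. -/
def toMap {d : ℕ} (M : Matrix (Fin d) (Fin d) ℝ) : E d →L[ℝ] E d :=
  Matrix.toEuclideanCLM (𝕜 := ℝ) M

/-- All (complex) eigenvalues have modulus strictly greater than `1`. -/
def IsExpanding {d : ℕ} (R : Matrix (Fin d) (Fin d) ℤ) : Prop :=
  ∀ z ∈ spectrum ℂ (R.map (Int.cast : ℤ → ℂ)), 1 < ‖z‖

/-- The matrix `[ (#B)^{-1/2} exp(-2πi (R⁻¹ b)·ℓ) ]` with rows `b ∈ B` and columns `ℓ ∈ L`. -/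
def hadamardMatrix {d : ℕ} (R : Matrix (Fin d) (Fin d) ℤ) (B L : Finset (Fin d → ℤ)) :
    Matrix B L ℂ :=
  fun b l => (1 / (Real.sqrt (B.card : ℝ) : ℂ)) *
    Complex.exp (-2 * Real.pi * Complex.I *
      (inner ℝ (toMap (realMat R)⁻¹ (intVec b.1)) (intVec l.1) : ℝ))

/-- `(R, B)` is an admissible pair: `R` is an expanding integral matrix, `B` is a (nonempty) finite
set of integral vectors, and for some finite `L ⊆ ℤ^d` with `#L = #B` the matrix above is
unitary. -/
structure IsAdmissiblePair {d : ℕ} (R : Matrix (Fin d) (Fin d) ℤ) (B : Finset (Fin d → ℤ)) :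
    Prop where
  expanding : IsExpanding R
  nonempty : B.Nonempty
  hadamard : ∃ L : Finset (Fin d → ℤ), L.card = B.card ∧
    hadamardMatrix R B L * (hadamardMatrix R B L).conjTranspose = 1 ∧
    (hadamardMatrix R B L).conjTranspose * hadamardMatrix R B L = 1

open Classical in
/-- The finite set `M⁻¹ B ⊆ ℝ^d`. -/
def invImage {d : ℕ} (M : Matrix (Fin d) (Fin d) ℝ) (B : Finset (Fin d → ℤ)) : Finset (E d) :=
  B.image (fun b => toMap M⁻¹ (intVec b))

/-- The discrete measure `δ_A = (1 / #A) ∑_{a ∈ A} δ_a`. -/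
def discreteMeasure {d : ℕ} (A : Finset (E d)) : Measure (E d) :=
  (A.card : ENNReal)⁻¹ • ∑ a ∈ A, Measure.dirac a

/-- The product `R_n ⋯ R_2 R_1`. Sequences are indexed from `0`, so that the `n`-th matrix `R_n` of
the mathematical text is `R (n - 1)` here. -/
def cumProd {d : ℕ} (R : ℕ → Matrix (Fin d) (Fin d) ℤ) : ℕ → Matrix (Fin d) (Fin d) ℝ
  | 0 => 1
  | n + 1 => realMat (R n) * cumProd R n

/-- The product `R_1⁻¹ R_2⁻¹ ⋯ R_n⁻¹`. -/
def invProd {d : ℕ} (R : ℕ → Matrix (Fin d) (Fin d) ℤ) : ℕ → Matrix (Fin d) (Fin d) ℝ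
  | 0 => 1
  | n + 1 => invProd R n * (realMat (R n))⁻¹

/-- The finite convolution
`μ_n = δ_{R_1⁻¹ B_1} ∗ δ_{(R_2 R_1)⁻¹ B_2} ∗ ⋯ ∗ δ_{(R_n ⋯ R_1)⁻¹ B_n}`, with `μ_0 = δ_0`. -/
def finiteConv {d : ℕ} (R : ℕ → Matrix (Fin d) (Fin d) ℤ) (B : ℕ → Finset (Fin d → ℤ)) :
    ℕ → Measure (E d)
  | 0 => Measure.dirac 0
  | n + 1 =>
    Measure.conv (finiteConv R B n) (discreteMeasure (invImage (cumProd R (n + 1)) (B n)))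

/-- Weak convergence, tested on bounded continuous functions. -/
def WeaklyConverges {d : ℕ} (μs : ℕ → Measure (E d)) (μ : Measure (E d)) : Prop :=
  ∀ f : BoundedContinuousFunction (E d) ℝ,
    Tendsto (fun n => ∫ x, f x ∂(μs n)) atTop (𝓝 (∫ x, f x ∂μ))

/-- The Borel probability measure `μ` is the infinite convolution of the sequence `(R_n, B_n)`,
that is, the weak limit of the finite convolutions `μ_n`. -/
def IsInfiniteConvolution {d : ℕ} (R : ℕ → Matrix (Fin d) (Fin d) ℤ)
    (B : ℕ → Finset (Fin d → ℤ)) (μ : Measure (E d)) : Prop :=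
  IsProbabilityMeasure μ ∧ WeaklyConverges (finiteConv R B) μ

/-- `Λ` is a spectrum of `μ`: it is countable and the family `e_λ(x) = exp(2πi λ·x)`, `λ ∈ Λ`, is
an orthonormal (Hilbert) basis of `L²(μ)`. -/
def IsSpectrum {d : ℕ} (μ : Measure (E d)) (Λ : Set (E d)) : Prop :=
  Λ.Countable ∧ ∃ e : HilbertBasis Λ ℂ (Lp ℂ 2 μ), ∀ l : Λ,
    (e l : E d → ℂ) =ᵐ[μ] fun x =>
      Complex.exp (2 * Real.pi * Complex.I * (inner ℝ (l : E d) x : ℝ))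

/-- The cube `t + [0,1]^d`. -/
def unitCube {d : ℕ} (t : E d) : Set (E d) := {x | ∀ i, t i ≤ x i ∧ x i ≤ t i + 1}

end SpectralConv

end

open SpectralConv

/-!
By induction on `n`, the Hadamard condition provides finite spectra of the convolutions `μ_n`. Such
a spectrum remains one when its elements are moved by the lattice of periods `(R_n ⋯ R_1)ᵀ ℤ^d` of
the Fourier transform of `μ_n`, and it extends to a spectrum of `μ_m` for every `m ≥ n`.

Writing `μ̂(ξ) = μ̂_n(ξ) ν̂_n((R_n ⋯ R_1)^{-T} ξ)` with `ν_n` the tail of the convolution, these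
translations are used to keep the second factor bounded away from zero. This is possible because
`ν_n` lives on a unit cube and gives a fixed amount of mass to a compact subset of its interior. The
points of this interior are separated from all others of the cube by the projection to the torus
`ℝ^d / ℤ^d`, so `ν̂_n` cannot vanish on a whole coset `ξ + ℤ^d`, and by compactness some value on
each coset is bounded below uniformly in `n`.

With `Λ` the union of the chosen spectra, dominated convergence turns the Parseval identities for
`μ_n` into `∑_{λ ∈ Λ} |μ̂(ξ + λ)|² = 1` for all `ξ`, which by Jorgensen and Pedersen says that `Λ`
is a spectrum of `μ`. The measure `μ` itself is the law of a sum of independent random digits,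
which converges since the images of the cube under the first `n` contractions shrink to a point.
-/

noncomputable section

namespace SpectralConv

variable {d : ℕ}

section IntegralMatrices

lemma intVec_add (k l : Fin d → ℤ) : intVec (k + l) = intVec k + intVec l := by
  ext i; simp [intVec]

lemma intVec_zero : intVec (0 : Fin d → ℤ) = 0 := by
  ext i; simp [intVec]

lemma intVec_sub (k l : Fin d → ℤ) : intVec (k - l) = intVec k - intVec l := by
  ext i; simp [intVec]

lemma intVec_injective : Function.Injective (intVec : (Fin d → ℤ) → E d) := by
  intro k l h
  ext i
  simpa [intVec] using congrArg (fun v : E d => v i) h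

lemma inner_intVec (k l : Fin d → ℤ) : inner ℝ (intVec k) (intVec l) = ((k ⬝ᵥ l : ℤ) : ℝ) := by
  simp [intVec, PiLp.inner_apply, dotProduct, mul_comm]

lemma toMap_mul (M N : Matrix (Fin d) (Fin d) ℝ) (x : E d) :
    toMap (M * N) x = toMap M (toMap N x) := by
  simp [toMap]

lemma toMap_one (x : E d) : toMap (1 : Matrix (Fin d) (Fin d) ℝ) x = x := by
  simp [toMap]

lemma toMap_inv_apply {M : Matrix (Fin d) (Fin d) ℝ} (hM : IsUnit M.det) (x : E d) :
    toMap M⁻¹ (toMap M x) = x := by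
  rw [← toMap_mul, Matrix.nonsing_inv_mul _ hM, toMap_one]

lemma toMap_apply_inv {M : Matrix (Fin d) (Fin d) ℝ} (hM : IsUnit M.det) (x : E d) :
    toMap M (toMap M⁻¹ x) = x := by
  rw [← toMap_mul, Matrix.mul_nonsing_inv _ hM, toMap_one]

lemma injective_toMap_inv {M : Matrix (Fin d) (Fin d) ℝ} (hM : IsUnit M.det) :
    Function.Injective (toMap M⁻¹) :=
  Function.LeftInverse.injective (toMap_apply_inv hM)

lemma toMap_transpose (M : Matrix (Fin d) (Fin d) ℝ) :
    toMap M.transpose = ContinuousLinearMap.adjoint (toMap M) := by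
  have h := map_star (Matrix.toEuclideanCLM (n := Fin d) (𝕜 := ℝ)) M
  rwa [ContinuousLinearMap.star_eq_adjoint, Matrix.star_eq_conjTranspose,
    Matrix.conjTranspose_eq_transpose_of_trivial] at h

lemma norm_toMap_transpose (M : Matrix (Fin d) (Fin d) ℝ) : ‖toMap M.transpose‖ = ‖toMap M‖ := by
  rw [toMap_transpose, LinearIsometryEquiv.norm_map]

lemma inner_toMap (M : Matrix (Fin d) (Fin d) ℝ) (x y : E d) :
    inner ℝ (toMap M x) y = inner ℝ x (toMap M.transpose y) := by
  rw [toMap_transpose, ContinuousLinearMap.adjoint_inner_right]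

lemma toMap_realMat_intVec (M : Matrix (Fin d) (Fin d) ℤ) (k : Fin d → ℤ) :
    toMap (realMat M) (intVec k) = intVec (M.mulVec k) := by
  ext i
  simp [toMap, intVec, realMat, Matrix.mulVec, dotProduct]

lemma realMat_mul (M N : Matrix (Fin d) (Fin d) ℤ) : realMat (M * N) = realMat M * realMat N :=
  Matrix.map_mul (f := Int.castRingHom ℝ)

lemma realMat_one : realMat (1 : Matrix (Fin d) (Fin d) ℤ) = 1 :=
  Matrix.map_one _ Int.cast_zero Int.cast_one

lemma IsExpanding.isUnit_det {R : Matrix (Fin d) (Fin d) ℤ} (h : IsExpanding R) :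
    IsUnit (realMat R).det := by
  have h0 : (0 : ℂ) ∉ spectrum ℂ (R.map (Int.cast : ℤ → ℂ)) := fun h0 =>
    (h 0 h0).not_ge (by simp)
  have hℂ : (R.map (Int.cast : ℤ → ℂ)).det = (R.det : ℂ) := ((Int.castRingHom ℂ).map_det R).symm
  have hℝ : (realMat R).det = (R.det : ℝ) := ((Int.castRingHom ℝ).map_det R).symm
  rw [spectrum.zero_notMem_iff, Matrix.isUnit_iff_isUnit_det, hℂ, isUnit_iff_ne_zero] at h0
  rw [hℝ, isUnit_iff_ne_zero]
  exact_mod_cast h0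

end IntegralMatrices

section PartialProducts

variable {R : ℕ → Matrix (Fin d) (Fin d) ℤ}

/-- The integral matrix `R_n ⋯ R_2 R_1`, of which `cumProd R n` is the real form. -/
def intCumProd (R : ℕ → Matrix (Fin d) (Fin d) ℤ) : ℕ → Matrix (Fin d) (Fin d) ℤ
  | 0 => 1
  | n + 1 => R n * intCumProd R n

/-- The map `ξ ↦ (R_n ⋯ R_1)^{-T} ξ`, by which the first `n` contractions act on frequencies. -/
def dualMap (R : ℕ → Matrix (Fin d) (Fin d) ℤ) (n : ℕ) : E d →L[ℝ] E d :=
  toMap ((cumProd R n)⁻¹).transpose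

lemma realMat_intCumProd (R : ℕ → Matrix (Fin d) (Fin d) ℤ) (n : ℕ) :
    realMat (intCumProd R n) = cumProd R n := by
  induction n with
  | zero => exact realMat_one
  | succ n ih => rw [intCumProd, realMat_mul, ih, cumProd]

lemma isUnit_det_cumProd (hR : ∀ n, IsUnit (realMat (R n)).det) (n : ℕ) :
    IsUnit (cumProd R n).det := by
  induction n with
  | zero => simp [cumProd]
  | succ n ih => rw [cumProd, Matrix.det_mul]; exact (hR n).mul ih

lemma invProd_eq_inv_cumProd (R : ℕ → Matrix (Fin d) (Fin d) ℤ) (n : ℕ) :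
    invProd R n = (cumProd R n)⁻¹ := by
  induction n with
  | zero => simp [invProd, cumProd]
  | succ n ih => rw [invProd, cumProd, Matrix.mul_inv_rev, ih]

lemma cumProd_add (R : ℕ → Matrix (Fin d) (Fin d) ℤ) (n m : ℕ) :
    cumProd R (n + m) = cumProd (fun k => R (n + k)) m * cumProd R n := by
  induction m with
  | zero => simp [cumProd]
  | succ m ih => rw [← add_assoc, cumProd, cumProd, ih, Matrix.mul_assoc]

lemma dualMap_add (R : ℕ → Matrix (Fin d) (Fin d) ℤ) (n m : ℕ) (ξ : E d) :
    dualMap R (n + m) ξ = dualMap (fun k => R (n + k)) m (dualMap R n ξ) := by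
  rw [dualMap, dualMap, dualMap, cumProd_add, Matrix.mul_inv_rev, Matrix.transpose_mul, toMap_mul]

lemma dualMap_succ (R : ℕ → Matrix (Fin d) (Fin d) ℤ) (n : ℕ) (ξ : E d) :
    dualMap R (n + 1) ξ = toMap ((realMat (R n))⁻¹).transpose (dualMap R n ξ) := by
  rw [dualMap_add]
  simp [dualMap, cumProd]

lemma dualMap_intVec (hR : ∀ n, IsUnit (realMat (R n)).det) (n : ℕ) (k : Fin d → ℤ) :
    dualMap R n (intVec ((intCumProd R n).transpose.mulVec k)) = intVec k := by
  have hdet : IsUnit (cumProd R n).transpose.det := by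
    rw [Matrix.det_transpose]; exact isUnit_det_cumProd hR n
  have hcoe : realMat (intCumProd R n).transpose = (cumProd R n).transpose := by
    rw [← realMat_intCumProd]; rfl
  rw [← toMap_realMat_intVec, hcoe, dualMap, Matrix.transpose_nonsing_inv, toMap_inv_apply hdet]

lemma tendsto_dualMap (hlim : Tendsto (fun n => ‖toMap (invProd R n)‖) atTop (𝓝 0)) (ξ : E d) :
    Tendsto (fun n => dualMap R n ξ) atTop (𝓝 0) := by
  refine squeeze_zero_norm (fun n => (dualMap R n).le_opNorm ξ) ?_
  simpa only [dualMap, norm_toMap_transpose, ← invProd_eq_inv_cumProd, zero_mul]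
    using hlim.mul_const ‖ξ‖

lemma tendsto_invProd_shift (hR : ∀ n, IsUnit (realMat (R n)).det)
    (hlim : Tendsto (fun n => ‖toMap (invProd R n)‖) atTop (𝓝 0)) (n : ℕ) :
    Tendsto (fun m => ‖toMap (invProd (fun k => R (n + k)) m)‖) atTop (𝓝 0) := by
  have hshift : ∀ m, invProd (fun k => R (n + k)) m = cumProd R n * invProd R (m + n) := by
    intro m
    rw [invProd_eq_inv_cumProd, invProd_eq_inv_cumProd, add_comm m n, cumProd_add,
      Matrix.mul_inv_rev, Matrix.mul_nonsing_inv_cancel_left _ _ (isUnit_det_cumProd hR n)]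
  have hle : ∀ m, ‖toMap (invProd (fun k => R (n + k)) m)‖ ≤
      ‖toMap (cumProd R n)‖ * ‖toMap (invProd R (m + n))‖ := by
    intro m
    rw [hshift, toMap, map_mul]
    exact norm_mul_le _ _
  refine squeeze_zero (fun m => norm_nonneg _) hle ?_
  simpa only [Function.comp_def, mul_zero] using
    (hlim.comp (tendsto_add_atTop_nat n)).const_mul ‖toMap (cumProd R n)‖

end PartialProducts

section Characters

/-- The character `x ↦ exp (2πi ξ·x)` of `ℝ^d`. -/
def expo (ξ x : E d) : ℂ := Real.fourierChar (inner ℝ ξ x)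

lemma expo_eq_exp (ξ x : E d) :
    expo ξ x = Complex.exp (2 * Real.pi * Complex.I * (inner ℝ ξ x : ℝ)) := by
  rw [expo, Real.fourierChar_apply]
  push_cast; ring_nf

lemma expo_comm (ξ x : E d) : expo ξ x = expo x ξ := by
  rw [expo, expo, real_inner_comm]

lemma expo_add_left (ξ η x : E d) : expo (ξ + η) x = expo ξ x * expo η x := by
  rw [expo, inner_add_left, AddChar.map_add_eq_mul, Circle.coe_mul, ← expo, ← expo]

lemma expo_add_right (ξ x y : E d) : expo ξ (x + y) = expo ξ x * expo ξ y := by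
  rw [expo_comm, expo_add_left, expo_comm x, expo_comm y]

lemma expo_zero_left (x : E d) : expo 0 x = 1 := by simp [expo]

lemma expo_neg_left (ξ x : E d) : expo (-ξ) x = starRingEnd ℂ (expo ξ x) := by
  rw [expo, inner_neg_left, AddChar.map_neg_eq_inv, Circle.coe_inv_eq_conj, ← expo]

lemma norm_expo (ξ x : E d) : ‖expo ξ x‖ = 1 := Circle.norm_coe _

lemma continuous_expo (ξ : E d) : Continuous (expo ξ) := by
  unfold expo; fun_prop

lemma expo_toMap (M : Matrix (Fin d) (Fin d) ℝ) (ξ x : E d) :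
    expo (toMap M ξ) x = expo ξ (toMap M.transpose x) := by
  rw [expo, expo, inner_toMap]

lemma expo_intVec_intVec (k l : Fin d → ℤ) : expo (intVec k) (intVec l) = 1 := by
  rw [expo_eq_exp, inner_intVec, Complex.exp_eq_one_iff]
  exact ⟨k ⬝ᵥ l, by push_cast; ring⟩

end Characters

section FourierTransform

/-- The Fourier transform `ξ ↦ ∫ exp (2πi ξ·x) dμ(x)` of a measure, with the sign and normalisation
that make `fhat μ (l - k)` the inner product in `L²(μ)` of the characters of `k` and `l`. -/
def fhat (μ : Measure (E d)) (ξ : E d) : ℂ := ∫ x, expo ξ x ∂μ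

lemma fhat_eq_charFun (μ : Measure (E d)) (ξ : E d) :
    fhat μ ξ = charFun μ ((2 * Real.pi) • ξ) := by
  rw [fhat, charFun_apply]
  congr 1 with x
  rw [expo_eq_exp, inner_smul_right, real_inner_comm]
  push_cast; ring_nf

lemma fhat_conv (μ ν : Measure (E d)) [IsFiniteMeasure μ] [IsFiniteMeasure ν] (ξ : E d) :
    fhat (Measure.conv μ ν) ξ = fhat μ ξ * fhat ν ξ := by
  simp only [fhat_eq_charFun, charFun_conv]

lemma fhat_dirac (a ξ : E d) : fhat (Measure.dirac a) ξ = expo ξ a :=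
  integral_dirac _ _

lemma fhat_zero (μ : Measure (E d)) [IsProbabilityMeasure μ] : fhat μ 0 = 1 := by
  simp [fhat, expo_zero_left]

lemma integrable_expo (μ : Measure (E d)) [IsFiniteMeasure μ] (ξ : E d) :
    Integrable (expo ξ) μ :=
  .of_bound (continuous_expo ξ).aestronglyMeasurable 1 (.of_forall fun x => (norm_expo ξ x).le)

end FourierTransform

section Mask

/-- The mask polynomial `m_B(ξ) = (1 / #B) ∑_{b ∈ B} exp (2πi b·ξ)`, the Fourier transform of the
uniform measure on `B`. -/
def mask (B : Finset (Fin d → ℤ)) (ξ : E d) : ℂ :=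
  (B.card : ℂ)⁻¹ * ∑ b ∈ B, expo (intVec b) ξ

lemma mask_add_intVec (B : Finset (Fin d → ℤ)) (ξ : E d) (k : Fin d → ℤ) :
    mask B (ξ + intVec k) = mask B ξ := by
  simp only [mask, expo_add_right, expo_intVec_intVec, mul_one]

/-- A pair satisfying the Hadamard condition of an admissible pair, the matrix `R` being required
to be invertible but not necessarily expanding. -/
structure IsHadamardPair (R : Matrix (Fin d) (Fin d) ℤ) (B : Finset (Fin d → ℤ)) : Prop where
  isUnit_det : IsUnit (realMat R).det
  nonempty : B.Nonempty
  exists_hadamard : ∃ L : Finset (Fin d → ℤ),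
    hadamardMatrix R B L * (hadamardMatrix R B L).conjTranspose = 1

lemma IsAdmissiblePair.isHadamardPair {R : Matrix (Fin d) (Fin d) ℤ} {B : Finset (Fin d → ℤ)}
    (h : IsAdmissiblePair R B) : IsHadamardPair R B :=
  ⟨h.expanding.isUnit_det, h.nonempty, h.hadamard.imp fun _ hL => hL.2.1⟩

lemma star_dotProduct_self {ι : Type*} [Fintype ι] (w : ι → ℂ) :
    star w ⬝ᵥ w = ((∑ i, ‖w i‖ ^ 2 : ℝ) : ℂ) := by
  simp [dotProduct, Complex.conj_mul']

lemma sum_norm_conjTranspose_mulVec_sq {m n : Type*} [Fintype m] [DecidableEq m] [Fintype n]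
    {H : Matrix m n ℂ} (hH : H * H.conjTranspose = 1) (v : m → ℂ) :
    ∑ j, ‖H.conjTranspose.mulVec v j‖ ^ 2 = ∑ i, ‖v i‖ ^ 2 := by
  have h : star (H.conjTranspose.mulVec v) ⬝ᵥ H.conjTranspose.mulVec v = star v ⬝ᵥ v := by
    rw [Matrix.star_mulVec, Matrix.conjTranspose_conjTranspose, Matrix.dotProduct_mulVec,
      Matrix.vecMul_vecMul, hH, Matrix.vecMul_one]
  rw [star_dotProduct_self, star_dotProduct_self] at h
  exact Complex.ofReal_injective h

lemma star_hadamardMatrix_apply (R : Matrix (Fin d) (Fin d) ℤ) {B L : Finset (Fin d → ℤ)}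
    (b : B) (l : L) :
    star (hadamardMatrix R B L b l) = (Real.sqrt B.card : ℂ)⁻¹ *
      expo (intVec b) (toMap (realMat R)⁻¹.transpose (intVec l)) := by
  rw [hadamardMatrix, star_mul', ← expo_toMap, expo_eq_exp, Complex.star_def, ← Complex.exp_conj]
  simp [Complex.conj_ofNat]

lemma mask_eq_conjTranspose_mulVec (R : Matrix (Fin d) (Fin d) ℤ) {B L : Finset (Fin d → ℤ)}
    (η : E d) (l : L) :
    mask B (toMap (realMat R)⁻¹.transpose (η + intVec l)) = (Real.sqrt B.card : ℂ)⁻¹ *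
      (hadamardMatrix R B L).conjTranspose.mulVec
        (fun b => expo (intVec b) (toMap (realMat R)⁻¹.transpose η)) l := by
  have hsqrt : (B.card : ℂ)⁻¹ = (Real.sqrt B.card : ℂ)⁻¹ * (Real.sqrt B.card : ℂ)⁻¹ := by
    rw [← mul_inv, ← Complex.ofReal_mul, Real.mul_self_sqrt (Nat.cast_nonneg _),
      Complex.ofReal_natCast]
  rw [mask, hsqrt, mul_assoc, ← Finset.sum_coe_sort B, Finset.mul_sum, Matrix.mulVec, dotProduct]
  congr 1
  refine Finset.sum_congr rfl fun b _ => ?_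
  rw [Matrix.conjTranspose_apply, star_hadamardMatrix_apply, map_add, expo_add_right]
  ring

lemma sum_norm_mask_sq_of_hadamard {R : Matrix (Fin d) (Fin d) ℤ} {B L : Finset (Fin d → ℤ)}
    (hB : B.Nonempty) (h : hadamardMatrix R B L * (hadamardMatrix R B L).conjTranspose = 1)
    (η : E d) :
    ∑ l ∈ L, ‖mask B (toMap (realMat R)⁻¹.transpose (η + intVec l))‖ ^ 2 = 1 := by
  have hcard : (0 : ℝ) < B.card := by exact_mod_cast hB.card_pos
  rw [← Finset.sum_coe_sort L]
  simp_rw [mask_eq_conjTranspose_mulVec, norm_mul, mul_pow]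
  rw [← Finset.mul_sum, sum_norm_conjTranspose_mulVec_sq h]
  simp [norm_expo, hcard.ne']

lemma IsHadamardPair.exists_frequencies {R : Matrix (Fin d) (Fin d) ℤ}
    {B : Finset (Fin d → ℤ)} (h : IsHadamardPair R B) :
    ∃ L : Finset (Fin d → ℤ), 0 ∈ L ∧ ∀ η : E d,
      ∑ l ∈ L, ‖mask B (toMap (realMat R)⁻¹.transpose (η + intVec l))‖ ^ 2 = 1 := by
  classical
  obtain ⟨L, hL⟩ := h.exists_hadamard
  have hsum := sum_norm_mask_sq_of_hadamard h.nonempty hL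
  obtain ⟨l₀, hl₀⟩ : L.Nonempty := by
    by_contra! hne
    simpa [hne] using hsum 0
  refine ⟨L.image (· - l₀), Finset.mem_image.2 ⟨l₀, hl₀, sub_self _⟩, fun η => ?_⟩
  rw [Finset.sum_image sub_left_injective.injOn, ← hsum (η - intVec l₀)]
  simp only [intVec_sub, sub_add_eq_add_sub, add_sub_assoc]

end Mask

section FiniteConvolution

lemma isProbabilityMeasure_discreteMeasure {A : Finset (E d)} (hA : A.Nonempty) :
    IsProbabilityMeasure (discreteMeasure A) := by
  have hcard : (A.card : ENNReal) ≠ 0 := by exact_mod_cast hA.card_pos.ne'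
  exact ⟨by simp [discreteMeasure, ENNReal.inv_mul_cancel hcard]⟩

instance isFiniteMeasure_discreteMeasure (A : Finset (E d)) :
    IsFiniteMeasure (discreteMeasure A) := by
  rcases A.eq_empty_or_nonempty with rfl | hA
  · simp only [discreteMeasure, Finset.sum_empty, smul_zero]; infer_instance
  · have := isProbabilityMeasure_discreteMeasure hA
    infer_instance

lemma invImage_nonempty (M : Matrix (Fin d) (Fin d) ℝ) {B : Finset (Fin d → ℤ)}
    (hB : B.Nonempty) : (invImage M B).Nonempty :=
  hB.image _

lemma card_invImage {M : Matrix (Fin d) (Fin d) ℝ} (hM : IsUnit M.det)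
    (B : Finset (Fin d → ℤ)) : (invImage M B).card = B.card :=
  Finset.card_image_of_injective _ ((injective_toMap_inv hM).comp intVec_injective)

lemma fhat_discreteMeasure (A : Finset (E d)) (ξ : E d) :
    fhat (discreteMeasure A) ξ = (A.card : ℂ)⁻¹ * ∑ a ∈ A, expo ξ a := by
  rw [fhat, discreteMeasure, integral_smul_measure,
    integral_finsetSum_measure fun a _ => integrable_expo _ ξ]
  simp [Complex.real_smul]

lemma fhat_discreteMeasure_invImage {M : Matrix (Fin d) (Fin d) ℝ} (hM : IsUnit M.det)
    (B : Finset (Fin d → ℤ)) (ξ : E d) :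
    fhat (discreteMeasure (invImage M B)) ξ = mask B (toMap M⁻¹.transpose ξ) := by
  have hinj : Function.Injective fun b : Fin d → ℤ => toMap M⁻¹ (intVec b) :=
    (injective_toMap_inv hM).comp intVec_injective
  rw [fhat_discreteMeasure, card_invImage hM, mask, invImage, Finset.sum_image hinj.injOn]
  simp only [expo_comm ξ, expo_toMap]

variable {R : ℕ → Matrix (Fin d) (Fin d) ℤ} {B : ℕ → Finset (Fin d → ℤ)}

instance isFiniteMeasure_finiteConv (n : ℕ) : IsFiniteMeasure (finiteConv R B n) := by
  induction n with
  | zero => rw [finiteConv]; infer_instance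
  | succ n ih => rw [finiteConv]; infer_instance

lemma isProbabilityMeasure_finiteConv (hB : ∀ n, (B n).Nonempty) (n : ℕ) :
    IsProbabilityMeasure (finiteConv R B n) := by
  induction n with
  | zero => rw [finiteConv]; infer_instance
  | succ n ih =>
    have := isProbabilityMeasure_discreteMeasure (invImage_nonempty (cumProd R (n + 1)) (hB n))
    rw [finiteConv]
    infer_instance

lemma fhat_finiteConv_zero (ξ : E d) : fhat (finiteConv R B 0) ξ = 1 := by
  rw [finiteConv, fhat_dirac, expo_comm, expo_zero_left]

lemma fhat_finiteConv_succ (hR : ∀ n, IsUnit (realMat (R n)).det) (n : ℕ) (ξ : E d) :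
    fhat (finiteConv R B (n + 1)) ξ =
      fhat (finiteConv R B n) ξ * mask (B n) (dualMap R (n + 1) ξ) := by
  rw [finiteConv, fhat_conv, fhat_discreteMeasure_invImage (isUnit_det_cumProd hR _), dualMap]

lemma fhat_finiteConv_add (hR : ∀ n, IsUnit (realMat (R n)).det) (n m : ℕ) (ξ : E d) :
    fhat (finiteConv R B (n + m)) ξ = fhat (finiteConv R B n) ξ *
      fhat (finiteConv (fun k => R (n + k)) (fun k => B (n + k)) m) (dualMap R n ξ) := by
  induction m with
  | zero => rw [fhat_finiteConv_zero, mul_one, add_zero]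
  | succ m ih =>
    rw [← add_assoc, fhat_finiteConv_succ hR, ih, fhat_finiteConv_succ fun k => hR (n + k),
      add_assoc, dualMap_add, mul_assoc]

lemma fhat_finiteConv_add_period (hR : ∀ n, IsUnit (realMat (R n)).det) (n : ℕ) (ξ : E d)
    (k : Fin d → ℤ) :
    fhat (finiteConv R B n) (ξ + intVec ((intCumProd R n).transpose.mulVec k)) =
      fhat (finiteConv R B n) ξ := by
  induction n generalizing k with
  | zero => rw [fhat_finiteConv_zero, fhat_finiteConv_zero]
  | succ n ih =>
    rw [fhat_finiteConv_succ hR, map_add, dualMap_intVec hR, mask_add_intVec, intCumProd,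
      Matrix.transpose_mul, ← Matrix.mulVec_mulVec, ih, ← fhat_finiteConv_succ hR]

end FiniteConvolution

section FiniteSpectra

lemma eq_zero_of_hasSum_norm_sq_eq_one {G ι : Type*} [AddCommGroup G] {F : G → ℂ} (hF : F 0 = 1)
    {v : ι → G} (h : ∀ ξ, HasSum (fun i => ‖F (ξ + v i)‖ ^ 2) 1) {i j : ι} (hij : i ≠ j) :
    F (v j - v i) = 0 := by
  classical
  have hle : ∑ k ∈ {i, j}, ‖F (-v i + v k)‖ ^ 2 ≤ 1 :=
    sum_le_hasSum _ (fun k _ => sq_nonneg _) (h (-v i))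
  rw [Finset.sum_pair hij, neg_add_cancel, hF, norm_one, neg_add_eq_sub] at hle
  exact norm_eq_zero.1 (pow_eq_zero_iff two_ne_zero |>.1 (le_antisymm (by linarith) (sq_nonneg _)))

lemma injective_of_hasSum_norm_sq_eq_one {G ι : Type*} [AddCommGroup G] {F : G → ℂ}
    (hF : F 0 = 1) {v : ι → G} (h : ∀ ξ, HasSum (fun i => ‖F (ξ + v i)‖ ^ 2) 1) :
    Function.Injective v := by
  intro i j hv
  by_contra hij
  have h0 := eq_zero_of_hasSum_norm_sq_eq_one hF h hij
  rw [hv, sub_self, hF] at h0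
  exact one_ne_zero h0

/-- The characters of the finite set `Λ ⊆ ℤ^d` satisfy Parseval's identity against all characters
of `L²(μ)`: for a finitely supported `μ` this says that `Λ` is a spectrum of `μ`. -/
def IsFiniteSpectrum (μ : Measure (E d)) (Λ : Finset (Fin d → ℤ)) : Prop :=
  ∀ ξ, ∑ l ∈ Λ, ‖fhat μ (ξ + intVec l)‖ ^ 2 = 1

open Classical in
lemma isFiniteSpectrum_image {μ : Measure (E d)} [IsProbabilityMeasure μ] {ι : Type*}
    (s : Finset ι) (v : ι → Fin d → ℤ)
    (h : ∀ ξ, ∑ i ∈ s, ‖fhat μ (ξ + intVec (v i))‖ ^ 2 = 1) :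
    IsFiniteSpectrum μ (s.image v) := by
  have hinj : Function.Injective fun i : s => intVec (v i) :=
    injective_of_hasSum_norm_sq_eq_one (fhat_zero μ) fun ξ =>
      h ξ ▸ s.hasSum fun i => ‖fhat μ (ξ + intVec (v i))‖ ^ 2
  intro ξ
  rw [Finset.sum_image fun i hi j hj hij => ?_, h]
  exact congrArg Subtype.val (@hinj ⟨i, hi⟩ ⟨j, hj⟩ (congrArg intVec hij))

variable {R : ℕ → Matrix (Fin d) (Fin d) ℤ} {B : ℕ → Finset (Fin d → ℤ)}

lemma isFiniteSpectrum_zero : IsFiniteSpectrum (finiteConv R B 0) {0} := fun ξ => by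
  rw [Finset.sum_singleton, fhat_finiteConv_zero, norm_one, one_pow]

lemma IsFiniteSpectrum.exists_succ (hRB : ∀ n, IsHadamardPair (R n) (B n)) {n : ℕ}
    {Λ : Finset (Fin d → ℤ)} (h : IsFiniteSpectrum (finiteConv R B n) Λ) :
    ∃ Λ', Λ ⊆ Λ' ∧ IsFiniteSpectrum (finiteConv R B (n + 1)) Λ' := by
  classical
  have hR : ∀ n, IsUnit (realMat (R n)).det := fun n => (hRB n).isUnit_det
  have := isProbabilityMeasure_finiteConv (R := R) (fun n => (hRB n).nonempty) (n + 1)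
  obtain ⟨L, h0, hL⟩ := (hRB n).exists_frequencies
  let v : (Fin d → ℤ) × (Fin d → ℤ) → Fin d → ℤ := fun p =>
    p.1 + (intCumProd R n).transpose.mulVec p.2
  have hsplit : ∀ ξ l m, ‖fhat (finiteConv R B (n + 1)) (ξ + intVec (v (l, m)))‖ ^ 2 =
      ‖fhat (finiteConv R B n) (ξ + intVec l)‖ ^ 2 *
        ‖mask (B n) (toMap (realMat (R n))⁻¹.transpose
          (dualMap R n (ξ + intVec l) + intVec m))‖ ^ 2 := by
    intro ξ l m
    rw [intVec_add, ← add_assoc, fhat_finiteConv_succ hR, fhat_finiteConv_add_period hR,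
      dualMap_succ, map_add (dualMap R n) _ (intVec (Matrix.mulVec _ _)), dualMap_intVec hR,
      norm_mul, mul_pow]
  refine ⟨(Λ ×ˢ L).image v, fun l hl => ?_, isFiniteSpectrum_image _ _ fun ξ => ?_⟩
  · exact Finset.mem_image.2 ⟨(l, 0), Finset.mk_mem_product hl h0, by simp [v]⟩
  · simp only [Finset.sum_product, hsplit, ← Finset.mul_sum, hL, mul_one, h ξ]

lemma IsFiniteSpectrum.exists_of_le (hRB : ∀ n, IsHadamardPair (R n) (B n)) {n m : ℕ}
    (hnm : n ≤ m) {Λ : Finset (Fin d → ℤ)} (h : IsFiniteSpectrum (finiteConv R B n) Λ) :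
    ∃ Λ', Λ ⊆ Λ' ∧ IsFiniteSpectrum (finiteConv R B m) Λ' := by
  induction m, hnm using Nat.le_induction with
  | base => exact ⟨Λ, subset_rfl, h⟩
  | succ m _ ih =>
    obtain ⟨Λ₁, hΛ₁, h₁⟩ := ih
    obtain ⟨Λ₂, hΛ₂, h₂⟩ := h₁.exists_succ hRB
    exact ⟨Λ₂, hΛ₁.trans hΛ₂, h₂⟩

open Classical in
lemma IsFiniteSpectrum.image_add_period (hR : ∀ n, IsUnit (realMat (R n)).det)
    (hB : ∀ n, (B n).Nonempty) {n : ℕ} {Λ : Finset (Fin d → ℤ)}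
    (h : IsFiniteSpectrum (finiteConv R B n) Λ) (k : (Fin d → ℤ) → Fin d → ℤ) :
    IsFiniteSpectrum (finiteConv R B n)
      (Λ.image fun l => l + (intCumProd R n).transpose.mulVec (k l)) := by
  have := isProbabilityMeasure_finiteConv (R := R) hB n
  refine isFiniteSpectrum_image _ _ fun ξ => ?_
  simp only [intVec_add, ← add_assoc, fhat_finiteConv_add_period hR, h ξ]

end FiniteSpectra

section Totality

lemma fhat_injective {μ ν : Measure (E d)} [IsFiniteMeasure μ] [IsFiniteMeasure ν]
    (h : fhat μ = fhat ν) : μ = ν := by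
  refine Measure.ext_of_charFun (funext fun t => ?_)
  have ht : (2 * Real.pi) • ((2 * Real.pi)⁻¹ • t) = t := smul_inv_smul₀ (by positivity) t
  rw [← ht, ← fhat_eq_charFun, ← fhat_eq_charFun, h]

lemma integrable_mul_expo {μ : Measure (E d)} {f : E d → ℂ} (hf : Integrable f μ) (ξ : E d) :
    Integrable (fun x => f x * expo ξ x) μ :=
  hf.mul_bdd (c := 1) (continuous_expo ξ).aestronglyMeasurable
    (.of_forall fun x => (norm_expo ξ x).le)

lemma fhat_withDensity_ofReal {μ : Measure (E d)} {f : E d → ℝ} (hf : AEMeasurable f μ)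
    (ξ : E d) :
    fhat (μ.withDensity fun x => ENNReal.ofReal (f x)) ξ =
      ∫ x, ((max (f x) 0 : ℝ) : ℂ) * expo ξ x ∂μ := by
  rw [fhat, integral_withDensity_eq_integral_toReal_smul₀ hf.ennreal_ofReal
    (.of_forall fun x => ENNReal.ofReal_lt_top)]
  simp only [ENNReal.toReal_ofReal', Complex.real_smul]

-- The positive and negative parts of `g` are densities of two measures with the same transform.
lemma ae_eq_zero_of_integral_ofReal_mul_expo_eq_zero {μ : Measure (E d)} {g : E d → ℝ}
    (hg : Integrable g μ) (h : ∀ ξ, ∫ x, (g x : ℂ) * expo ξ x ∂μ = 0) : g =ᵐ[μ] 0 := by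
  have := isFiniteMeasure_withDensity_ofReal hg.2
  have := isFiniteMeasure_withDensity_ofReal hg.neg.2
  have hsub : ∀ x, g x = max (g x) 0 - max (-g x) 0 := fun x =>
    (max_zero_sub_max_neg_zero_eq_self (g x)).symm
  have hfhat : fhat (μ.withDensity fun x => ENNReal.ofReal (g x)) =
      fhat (μ.withDensity fun x => ENNReal.ofReal ((-g) x)) := by
    funext ξ
    rw [fhat_withDensity_ofReal hg.aemeasurable, fhat_withDensity_ofReal hg.neg.aemeasurable,
      ← sub_eq_zero, ← h ξ]
    refine (integral_sub (integrable_mul_expo hg.pos_part.ofReal ξ)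
      (integrable_mul_expo hg.neg.pos_part.ofReal ξ)).symm.trans ?_
    congr 1 with x
    rw [← sub_mul, ← RCLike.ofReal_sub, Pi.neg_apply, ← hsub]
    rfl
  have hdens : (fun x => ENNReal.ofReal (g x)) =ᵐ[μ] fun x => ENNReal.ofReal ((-g) x) :=
    (withDensity_eq_iff hg.aemeasurable.ennreal_ofReal hg.neg.aemeasurable.ennreal_ofReal
      hg.lintegral_lt_top.ne).1 (fhat_injective hfhat)
  filter_upwards [hdens] with x hx
  have hx' := congrArg ENNReal.toReal hx
  rw [ENNReal.toReal_ofReal', ENNReal.toReal_ofReal', Pi.neg_apply] at hx'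
  rw [hsub, hx', sub_self, Pi.zero_apply]

lemma ae_re_eq_zero_of_integral_mul_expo_eq_zero {μ : Measure (E d)} {g : E d → ℂ}
    (hg : Integrable g μ) (h : ∀ ξ, ∫ x, g x * expo ξ x ∂μ = 0) :
    (fun x => (g x).re) =ᵐ[μ] 0 := by
  have hconj : ∀ ξ, ∫ x, starRingEnd ℂ (g x) * expo ξ x ∂μ = 0 := by
    intro ξ
    rw [← map_zero (starRingEnd ℂ), ← h (-ξ), ← integral_conj]
    simp only [map_mul, expo_neg_left, Complex.conj_conj]
  have hgconj : Integrable (fun x => starRingEnd ℂ (g x)) μ :=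
    Complex.conjCLE.toContinuousLinearMap.integrable_comp hg
  refine ae_eq_zero_of_integral_ofReal_mul_expo_eq_zero hg.re fun ξ => ?_
  calc ∫ x, ((g x).re : ℂ) * expo ξ x ∂μ
      = ∫ x, (1 / 2 : ℂ) * (g x * expo ξ x + starRingEnd ℂ (g x) * expo ξ x) ∂μ := by
        congr 1 with x
        rw [Complex.re_eq_add_conj]; ring
    _ = 0 := by
        rw [integral_const_mul, integral_add (integrable_mul_expo hg ξ)
          (integrable_mul_expo hgconj ξ), h, hconj, add_zero, mul_zero]

lemma ae_eq_zero_of_integral_mul_expo_eq_zero {μ : Measure (E d)} {g : E d → ℂ}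
    (hg : Integrable g μ) (h : ∀ ξ, ∫ x, g x * expo ξ x ∂μ = 0) : g =ᵐ[μ] 0 := by
  have him := ae_re_eq_zero_of_integral_mul_expo_eq_zero (g := fun x => -Complex.I * g x)
    (hg.const_mul _) fun ξ => by simp only [mul_assoc, integral_const_mul, h, mul_zero]
  filter_upwards [ae_re_eq_zero_of_integral_mul_expo_eq_zero hg h, him] with x hre him
  exact Complex.ext hre (by simpa using him)

end Totality

section JorgensenPedersen

lemma memLp_expo (μ : Measure (E d)) [IsFiniteMeasure μ] (ξ : E d) : MemLp (expo ξ) 2 μ :=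
  .of_bound (continuous_expo ξ).aestronglyMeasurable 1 (.of_forall fun x => (norm_expo ξ x).le)

/-- The character `x ↦ exp (2πi ξ·x)` as an element of `L²(μ)`. -/
def expoLp (μ : Measure (E d)) [IsFiniteMeasure μ] (ξ : E d) : Lp ℂ 2 μ := (memLp_expo μ ξ).toLp

section

variable (μ : Measure (E d)) [IsFiniteMeasure μ]

lemma coeFn_expoLp (ξ : E d) : expoLp μ ξ =ᵐ[μ] expo ξ := (memLp_expo μ ξ).coeFn_toLp

lemma inner_expoLp (ξ : E d) (f : Lp ℂ 2 μ) :
    inner ℂ (expoLp μ ξ) f = ∫ x, f x * expo (-ξ) x ∂μ := by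
  rw [L2.inner_def]
  refine integral_congr_ae ?_
  filter_upwards [coeFn_expoLp μ ξ] with x hx
  rw [hx, expo_neg_left, RCLike.inner_apply]

lemma inner_expoLp_expoLp (ξ η : E d) : inner ℂ (expoLp μ ξ) (expoLp μ η) = fhat μ (η - ξ) := by
  rw [inner_expoLp, fhat]
  refine integral_congr_ae ?_
  filter_upwards [coeFn_expoLp μ η] with x hx
  rw [hx, sub_eq_add_neg, expo_add_left]

lemma eq_zero_of_inner_expoLp_eq_zero {f : Lp ℂ 2 μ} (h : ∀ ξ, inner ℂ (expoLp μ ξ) f = 0) :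
    f = 0 := by
  rw [Lp.eq_zero_iff_ae_eq_zero]
  refine ae_eq_zero_of_integral_mul_expo_eq_zero ((Lp.memLp f).integrable one_le_two) fun ξ => ?_
  rw [← neg_neg ξ, ← inner_expoLp, h]

lemma topologicalClosure_span_expoLp :
    (Submodule.span ℂ (Set.range (expoLp μ))).topologicalClosure = ⊤ := by
  rw [Submodule.topologicalClosure_eq_top_iff, Submodule.eq_bot_iff]
  exact fun f hf => eq_zero_of_inner_expoLp_eq_zero μ fun ξ =>
    (Submodule.mem_orthogonal _ f).1 hf _ (Submodule.subset_span ⟨ξ, rfl⟩)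

end

lemma norm_expoLp (μ : Measure (E d)) [IsProbabilityMeasure μ] (ξ : E d) : ‖expoLp μ ξ‖ = 1 := by
  rw [← sq_eq_sq₀ (norm_nonneg _) zero_le_one, ← inner_self_eq_norm_sq (𝕜 := ℂ),
    inner_expoLp_expoLp, sub_self, fhat_zero, RCLike.one_re, one_pow]

lemma mem_topologicalClosure_span_of_hasSum {𝕜 H ι : Type*} [RCLike 𝕜] [NormedAddCommGroup H]
    [InnerProductSpace 𝕜 H] [CompleteSpace H] {v : ι → H} (hv : Orthonormal 𝕜 v) {u : H}
    (hu : HasSum (fun i => ‖inner 𝕜 (v i) u‖ ^ 2) (‖u‖ ^ 2)) :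
    u ∈ (Submodule.span 𝕜 (Set.range v)).topologicalClosure := by
  set V := (Submodule.span 𝕜 (Set.range v)).topologicalClosure
  have hinner : ∀ i, inner 𝕜 (v i) (V.starProjection u) = inner 𝕜 (v i) u := fun i => by
    have hi : v i ∈ V := subset_closure (Submodule.subset_span ⟨i, rfl⟩)
    rw [← sub_eq_zero, ← inner_sub_right, ← neg_sub, inner_neg_right,
      V.mem_orthogonal _ |>.1 (V.sub_starProjection_mem_orthogonal u) _ hi, neg_zero]
  have hbessel : ‖u‖ ^ 2 ≤ ‖V.starProjection u‖ ^ 2 := by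
    rw [← hu.tsum_eq]
    simpa only [hinner] using hv.tsum_inner_products_le (V.starProjection u)
  rw [V.mem_iff_norm_starProjection]
  exact (V.norm_starProjection_apply_le u).antisymm (le_of_sq_le_sq hbessel (norm_nonneg _))

lemma isSpectrum_of_hasSum {μ : Measure (E d)} [IsProbabilityMeasure μ] {Λ : Set (E d)}
    (hΛ : Λ.Countable) (hsum : ∀ ξ, HasSum (fun l : Λ => ‖fhat μ (ξ + l)‖ ^ 2) 1) :
    IsSpectrum μ Λ := by
  have hv : Orthonormal ℂ fun l : Λ => expoLp μ l := by
    refine ⟨fun l => norm_expoLp μ l, fun l m hlm => ?_⟩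
    refine (inner_expoLp_expoLp μ l m).trans ?_
    exact eq_zero_of_hasSum_norm_sq_eq_one (fhat_zero μ) hsum hlm
  have hmem : ∀ ξ, expoLp μ ξ ∈
      (Submodule.span ℂ (Set.range fun l : Λ => expoLp μ l)).topologicalClosure := by
    refine fun ξ => mem_topologicalClosure_span_of_hasSum hv ?_
    rw [norm_expoLp, one_pow]
    convert hsum (-ξ) using 3 with l
    rw [norm_inner_symm, inner_expoLp_expoLp, neg_add_eq_sub]
  have htop : ⊤ ≤ (Submodule.span ℂ (Set.range fun l : Λ => expoLp μ l)).topologicalClosure := by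
    rw [← topologicalClosure_span_expoLp μ]
    exact Submodule.topologicalClosure_minimal _
      (Submodule.span_le.2 (Set.range_subset_iff.2 hmem))
      (Submodule.isClosed_topologicalClosure _)
  refine ⟨hΛ, HilbertBasis.mk hv htop, fun l => ?_⟩
  filter_upwards [coeFn_expoLp μ (l : E d)] with x hx
  rw [HilbertBasis.coe_mk, hx, expo_eq_exp]

end JorgensenPedersen

section UnitCube

lemma unitCube_eq_preimage_pi (t : E d) :
    unitCube t = (EuclideanSpace.equiv (Fin d) ℝ).toHomeomorph ⁻¹'
      (Set.univ.pi fun i => Set.Icc (t i) (t i + 1)) := by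
  ext x
  simp [unitCube, -Set.pi_univ_Icc, Set.mem_pi]

lemma isCompact_unitCube (t : E d) : IsCompact (unitCube t) := by
  rw [unitCube_eq_preimage_pi, Homeomorph.isCompact_preimage]
  exact isCompact_univ_pi fun i => isCompact_Icc

lemma self_mem_unitCube (t : E d) : t ∈ unitCube t := fun i => ⟨le_rfl, by linarith⟩

lemma mem_Ioo_of_mem_interior_unitCube {t x : E d} (hx : x ∈ interior (unitCube t)) (i : Fin d) :
    x i ∈ Set.Ioo (t i) (t i + 1) := by
  rw [unitCube_eq_preimage_pi, ← Homeomorph.preimage_interior,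
    interior_pi_set (Set.toFinite _)] at hx
  simp only [interior_Icc] at hx
  exact hx i (Set.mem_univ i)

lemma exists_sub_intVec_mem_unitCube_zero (x : E d) :
    ∃ k, x - intVec k ∈ unitCube (0 : E d) := by
  refine ⟨fun i => ⌊x i⌋, fun i => ?_⟩
  simp only [intVec, PiLp.sub_apply, PiLp.zero_apply, zero_add]
  exact ⟨Int.fract_nonneg (x i), (Int.fract_lt_one (x i)).le⟩

end UnitCube

section Torus

/-- The projection `ℝ^d → (ℝ/ℤ)^d`. -/
def toTorus (x : E d) : UnitAddTorus (Fin d) := fun i => (x i : UnitAddCircle)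

lemma continuous_toTorus : Continuous (toTorus : E d → UnitAddTorus (Fin d)) :=
  continuous_pi fun i => (AddCircle.continuous_mk' 1).comp (PiLp.continuous_apply 2 _ i)

lemma surjective_domRestrict_toTorus (t : E d) :
    Function.Surjective ((unitCube t).domRestrict toTorus) := by
  intro y
  have hy : ∀ i, ∃ u ∈ Set.Icc (t i) (t i + 1), (u : UnitAddCircle) = y i := fun i =>
    (AddCircle.coe_image_Icc_eq (1 : ℝ) (t i)).ge (Set.mem_univ (y i))
  choose u hu huy using hy
  exact ⟨⟨WithLp.toLp 2 u, hu⟩, funext huy⟩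

lemma eq_of_toTorus_eq {t x y : E d} (hx : x ∈ interior (unitCube t)) (hy : y ∈ unitCube t)
    (hxy : toTorus x = toTorus y) : x = y := by
  ext i
  have hxi := mem_Ioo_of_mem_interior_unitCube hx i
  have hyi := hy i
  obtain ⟨n, hn⟩ : ∃ n : ℤ, n • (1 : ℝ) = x i - y i := by
    rw [← AddCircle.coe_eq_zero_iff, AddCircle.coe_sub, sub_eq_zero]
    exact congrFun hxy i
  rw [zsmul_one] at hn
  have hn0 : n = 0 := by
    have hlt : (n : ℝ) < 1 := by linarith [hxi.2]
    have hgt : (-1 : ℝ) < n := by linarith [hxi.1]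
    norm_cast at hlt hgt
    lia
  rw [← sub_eq_zero, ← hn, hn0, Int.cast_zero]

lemma mFourier_toTorus (k : Fin d → ℤ) (x : E d) :
    UnitAddTorus.mFourier k (toTorus x) = expo (intVec k) x := by
  rw [expo_eq_exp, PiLp.inner_apply, Complex.ofReal_sum, Finset.mul_sum, Complex.exp_sum,
    UnitAddTorus.mFourier, ContinuousMap.coe_mk]
  refine Finset.prod_congr rfl fun i _ => ?_
  rw [toTorus, fourier_coe_apply]
  congr 1
  simp only [intVec, RCLike.inner_apply, conj_trivial]
  push_cast; ring

lemma exists_comp_toTorus_eq {t : E d} {f : E d → ℂ} (hf : Continuous f)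
    (hf0 : ∀ x ∉ interior (unitCube t), f x = 0) :
    ∃ G : C(UnitAddTorus (Fin d), ℂ), ∀ x ∈ unitCube t, G (toTorus x) = f x := by
  have : CompactSpace (unitCube t) := isCompact_iff_compactSpace.1 (isCompact_unitCube t)
  let π : C(unitCube t, UnitAddTorus (Fin d)) :=
    ⟨(unitCube t).domRestrict toTorus, continuous_toTorus.comp continuous_subtype_val⟩
  have hπ : IsQuotientMap π :=
    .of_surjective_continuous (surjective_domRestrict_toTorus t) π.continuous
  let F : C(unitCube t, ℂ) := ⟨(unitCube t).domRestrict f, hf.comp continuous_subtype_val⟩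
  have hF : Function.FactorsThrough F π := by
    intro x y hxy
    by_cases hx : (x : E d) ∈ interior (unitCube t)
    · exact congrArg f (eq_of_toTorus_eq hx y.2 hxy)
    by_cases hy : (y : E d) ∈ interior (unitCube t)
    · exact congrArg f (eq_of_toTorus_eq hy x.2 hxy.symm).symm
    · exact (hf0 x hx).trans (hf0 y hy).symm
  exact ⟨hπ.lift F hF, fun x hx => DFunLike.congr_fun (hπ.lift_comp F hF) ⟨x, hx⟩⟩

lemma exists_trigPolynomial_near {t : E d} {f : E d → ℂ} (hf : Continuous f)
    (hf0 : ∀ x ∉ interior (unitCube t), f x = 0) {η : ℝ} (hη : 0 < η) :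
    ∃ c : (Fin d → ℤ) →₀ ℂ, ∀ x ∈ unitCube t,
      ‖f x - ∑ k ∈ c.support, c k * expo (intVec k) x‖ ≤ η := by
  obtain ⟨G, hG⟩ := exists_comp_toTorus_eq hf hf0
  have hmem : G ∈ (Submodule.span ℂ
      (Set.range <| UnitAddTorus.mFourier (d := Fin d))).topologicalClosure := by
    rw [UnitAddTorus.span_mFourier_closure_eq_top]; trivial
  obtain ⟨p, hp, hpG⟩ := Metric.mem_closure_iff.1 hmem η hη
  obtain ⟨c, rfl⟩ := Finsupp.mem_span_range_iff_exists_finsupp.1 hp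
  refine ⟨c, fun x hx => ?_⟩
  have hcx : ∑ k ∈ c.support, c k * expo (intVec k) x =
      (c.sum fun k a => a • UnitAddTorus.mFourier k) (toTorus x) := by
    simp [Finsupp.sum, mFourier_toTorus]
  rw [hcx, ← hG x hx, ← dist_eq_norm]
  exact (ContinuousMap.dist_apply_le_dist _).trans hpG.le

end Torus

section Lipschitz

lemma norm_expo_sub_expo_le (ξ η x : E d) :
    ‖expo ξ x - expo η x‖ ≤ 2 * Real.pi * (‖x‖ * ‖ξ - η‖) := by
  have hfactor : expo ξ x - expo η x = expo η x * (expo (ξ - η) x - 1) := by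
    rw [mul_sub, ← expo_add_left, mul_one, add_sub_cancel]
  have hexp : expo (ξ - η) x = Complex.exp (Complex.I * (2 * Real.pi * inner ℝ (ξ - η) x : ℝ)) := by
    rw [expo_eq_exp]; push_cast; ring_nf
  calc ‖expo ξ x - expo η x‖ = ‖expo (ξ - η) x - 1‖ := by
        rw [hfactor, norm_mul, norm_expo, one_mul]
    _ ≤ ‖2 * Real.pi * inner ℝ (ξ - η) x‖ := by
        rw [hexp]; exact Real.norm_exp_I_mul_ofReal_sub_one_le
    _ = 2 * Real.pi * |inner ℝ x (ξ - η)| := by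
        rw [norm_mul, Real.norm_of_nonneg Real.two_pi_pos.le, Real.norm_eq_abs, real_inner_comm]
    _ ≤ 2 * Real.pi * (‖x‖ * ‖ξ - η‖) := by gcongr; exact abs_real_inner_le_norm _ _

lemma norm_fhat_sub_fhat_le {ν : Measure (E d)} [IsProbabilityMeasure ν] {M : ℝ}
    (hM : ∀ᵐ x ∂ν, ‖x‖ ≤ M) (ξ η : E d) :
    ‖fhat ν ξ - fhat ν η‖ ≤ 2 * Real.pi * M * ‖ξ - η‖ := by
  rw [fhat, fhat, ← integral_sub (integrable_expo ν ξ) (integrable_expo ν η)]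
  have hbound : ∀ᵐ x ∂ν, ‖expo ξ x - expo η x‖ ≤ 2 * Real.pi * M * ‖ξ - η‖ := by
    filter_upwards [hM] with x hx
    refine (norm_expo_sub_expo_le ξ η x).trans ?_
    rw [mul_assoc _ M]
    gcongr
  simpa using norm_integral_le_of_norm_le_const hbound

end Lipschitz

section EquiPositive

lemma half_le_norm_of_norm_sub_le {V W : Type*} [NormedAddCommGroup V] [NormedAddCommGroup W]
    {F : V → W} {L : ℝ} (hL : 0 < L) (hF : ∀ x y, ‖F x - F y‖ ≤ L * ‖x - y‖) {ε : ℝ} {x y : V}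
    (hx : ε ≤ ‖F x‖) (hxy : ‖x - y‖ ≤ ε / (2 * L)) : ε / 2 ≤ ‖F y‖ := by
  have hdiff : ‖F x - F y‖ ≤ ε / 2 := calc
    ‖F x - F y‖ ≤ L * (ε / (2 * L)) := (hF x y).trans (by gcongr)
    _ = ε / 2 := by field_simp
  linarith [norm_sub_norm_le (F x) (F y)]

/-- Equi-positivity of a family of measures: up to integral translations, which are not used at
`0`, the Fourier transforms of the family are bounded away from `0` on balls of a common radius. -/
def IsEquiPositive (Φ : Set (Measure (E d))) : Prop :=
  ∃ ε > 0, ∃ δ > 0, ∀ ν ∈ Φ, ∀ x : E d, ∃ k : Fin d → ℤ, (x = 0 → k = 0) ∧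
    ∀ y : E d, ‖y‖ < δ → ε ≤ ‖fhat ν (x + intVec k + y)‖

lemma exists_pos_forall_le_norm_fhat_add_intVec {Φ : Set (Measure (E d))} {L : ℝ} (hL : 0 < L)
    (hlip : ∀ ν ∈ Φ, ∀ ξ η, ‖fhat ν ξ - fhat ν η‖ ≤ L * ‖ξ - η‖)
    (h : ∀ ξ, ∃ ε > 0, ∀ ν ∈ Φ, ∃ k, ε ≤ ‖fhat ν (ξ + intVec k)‖) :
    ∃ ε > 0, ∀ ν ∈ Φ, ∀ ξ, ∃ k, ε ≤ ‖fhat ν (ξ + intVec k)‖ := by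
  obtain ⟨ε, hε, hcube⟩ : ∃ ε > 0, ∀ ν ∈ Φ, ∀ ξ ∈ unitCube (0 : E d), ∃ k,
      ε ≤ ‖fhat ν (ξ + intVec k)‖ := by
    refine (isCompact_unitCube (0 : E d)).induction_on
      (p := fun s => ∃ ε > 0, ∀ ν ∈ Φ, ∀ ξ ∈ s, ∃ k, ε ≤ ‖fhat ν (ξ + intVec k)‖)
      ⟨1, one_pos, by simp⟩ ?subset ?union ?nhds
    case subset =>
      rintro s s' hss ⟨ε, hε, hs'⟩
      exact ⟨ε, hε, fun ν hν ξ hξ => hs' ν hν ξ (hss hξ)⟩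
    case union =>
      rintro s s' ⟨ε, hε, hs⟩ ⟨ε', hε', hs'⟩
      refine ⟨min ε ε', lt_min hε hε', fun ν hν ξ hξ => hξ.elim (fun hξ => ?_) fun hξ => ?_⟩
      · exact (hs ν hν ξ hξ).imp fun k hk => (min_le_left _ _).trans hk
      · exact (hs' ν hν ξ hξ).imp fun k hk => (min_le_right _ _).trans hk
    case nhds =>
      intro ξ _
      obtain ⟨ε, hε, hξ⟩ := h ξ
      refine ⟨Metric.ball ξ (ε / (2 * L)), mem_nhdsWithin_of_mem_nhds
        (Metric.ball_mem_nhds _ (by positivity)), ε / 2, half_pos hε, fun ν hν x hx => ?_⟩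
      refine (hξ ν hν).imp fun k hk => half_le_norm_of_norm_sub_le hL (hlip ν hν) hk ?_
      rw [add_sub_add_right_eq_sub, norm_sub_rev, ← dist_eq_norm]
      exact (Metric.mem_ball.1 hx).le
  refine ⟨ε, hε, fun ν hν ξ => ?_⟩
  obtain ⟨k₀, hk₀⟩ := exists_sub_intVec_mem_unitCube_zero ξ
  obtain ⟨k, hk⟩ := hcube ν hν _ hk₀
  refine ⟨k - k₀, ?_⟩
  rwa [intVec_sub, add_sub_assoc', add_sub_right_comm]

-- The translation at `0` may be `0` because `fhat ν 0 = 1` for a probability measure `ν`.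
lemma isEquiPositive_of_forall_exists {Φ : Set (Measure (E d))}
    (hΦ : ∀ ν ∈ Φ, IsProbabilityMeasure ν) {M : ℝ} (hM : ∀ ν ∈ Φ, ∀ᵐ x ∂ν, ‖x‖ ≤ M)
    (h : ∀ ξ, ∃ ε > 0, ∀ ν ∈ Φ, ∃ k, ε ≤ ‖fhat ν (ξ + intVec k)‖) : IsEquiPositive Φ := by
  have hL : 0 < 2 * Real.pi * |M| + 1 := by positivity
  have hlip : ∀ ν ∈ Φ, ∀ ξ η, ‖fhat ν ξ - fhat ν η‖ ≤ (2 * Real.pi * |M| + 1) * ‖ξ - η‖ := by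
    intro ν hν ξ η
    have := hΦ ν hν
    refine (norm_fhat_sub_fhat_le (hM ν hν) ξ η).trans ?_
    gcongr
    linarith [mul_le_mul_of_nonneg_left (le_abs_self M) Real.two_pi_pos.le]
  obtain ⟨ε, hε, hεΦ⟩ := exists_pos_forall_le_norm_fhat_add_intVec hL hlip h
  refine ⟨min ε 1 / 2, by positivity, min ε 1 / (2 * (2 * Real.pi * |M| + 1)), by positivity,
    fun ν hν x => ?_⟩
  obtain ⟨k, hk0, hk⟩ : ∃ k, (x = 0 → k = 0) ∧ min ε 1 ≤ ‖fhat ν (x + intVec k)‖ := by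
    have := hΦ ν hν
    rcases eq_or_ne x 0 with rfl | hx
    · refine ⟨0, fun _ => rfl, ?_⟩
      rw [intVec_zero, add_zero, fhat_zero, norm_one]
      exact min_le_right _ _
    · exact (hεΦ ν hν x).imp fun k hk => ⟨fun h0 => absurd h0 hx, (min_le_left _ _).trans hk⟩
  refine ⟨k, hk0, fun y hy => half_le_norm_of_norm_sub_le hL (hlip ν hν) hk ?_⟩
  rw [sub_add_cancel_left, norm_neg]
  exact hy.le

end EquiPositive

section MassInsideCube

lemma integral_trigPolynomial_mul_expo (ν : Measure (E d)) [IsFiniteMeasure ν]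
    (c : (Fin d → ℤ) →₀ ℂ) (ξ : E d) :
    ∫ x, (∑ k ∈ c.support, c k * expo (intVec k) x) * expo ξ x ∂ν =
      ∑ k ∈ c.support, c k * fhat ν (ξ + intVec k) := by
  have hterm : ∀ k x, c k * expo (intVec k) x * expo ξ x = c k * expo (ξ + intVec k) x := by
    intro k x; rw [expo_add_left]; ring
  simp_rw [Finset.sum_mul, hterm]
  rw [integral_finsetSum _ fun k _ => (integrable_expo ν _).const_mul _]
  simp_rw [integral_const_mul, fhat]

lemma norm_integral_sub_sum_fhat_le {ν : Measure (E d)} [IsProbabilityMeasure ν] {f : E d → ℂ}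
    (hf : Integrable f ν) (a : (Fin d → ℤ) →₀ ℂ) (ξ : E d) {η : ℝ}
    (h : ∀ᵐ x ∂ν, ‖f x * expo (-ξ) x - ∑ k ∈ a.support, a k * expo (intVec k) x‖ ≤ η) :
    ‖∫ x, f x ∂ν - ∑ k ∈ a.support, a k * fhat ν (ξ + intVec k)‖ ≤ η := by
  have hpoly : Integrable (fun x => ∑ k ∈ a.support, a k * expo (intVec k) x) ν :=
    integrable_finsetSum _ fun k _ => (integrable_expo ν _).const_mul _
  rw [← integral_trigPolynomial_mul_expo, ← integral_sub hf (integrable_mul_expo hpoly ξ)]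
  have hbound : ∀ᵐ x ∂ν,
      ‖f x - (∑ k ∈ a.support, a k * expo (intVec k) x) * expo ξ x‖ ≤ η := by
    filter_upwards [h] with x hx
    have hfx : f x = f x * expo (-ξ) x * expo ξ x := by
      rw [mul_assoc, ← expo_add_left, neg_add_cancel, expo_zero_left, mul_one]
    rwa [hfx, ← sub_mul, norm_mul, norm_expo, mul_one]
  simpa using norm_integral_le_of_norm_le_const hbound

lemma integrable_of_ae_mem_isCompact {X F : Type*} [TopologicalSpace X] [MeasurableSpace X]
    [OpensMeasurableSpace X] [NormedAddCommGroup F] [SecondCountableTopologyEither X F]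
    {ν : Measure X} [IsFiniteMeasure ν] {K : Set X} (hK : IsCompact K) (hν : ∀ᵐ x ∂ν, x ∈ K)
    {f : X → F} (hf : Continuous f) : Integrable f ν := by
  obtain ⟨M, hM⟩ := hK.exists_bound_of_continuousOn hf.continuousOn
  exact .of_bound hf.aestronglyMeasurable M (hν.mono hM)

lemma exists_pos_forall_le_norm_fhat_of_le_integral {t : E d} {f : E d → ℂ} (hf : Continuous f)
    (hf0 : ∀ x ∉ interior (unitCube t), f x = 0) {c : ℝ} (hc : 0 < c) (ξ : E d) :
    ∃ ε > 0, ∀ ν : Measure (E d), IsProbabilityMeasure ν → (∀ᵐ x ∂ν, x ∈ unitCube t) →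
      c ≤ ‖∫ x, f x ∂ν‖ → ∃ k, ε ≤ ‖fhat ν (ξ + intVec k)‖ := by
  obtain ⟨a, ha⟩ := exists_trigPolynomial_near (t := t) (hf.mul (continuous_expo (-ξ)))
    (fun x hx => by rw [Pi.mul_apply, hf0 x hx, zero_mul]) (half_pos hc)
  have hS : 0 ≤ ∑ k ∈ a.support, ‖a k‖ := Finset.sum_nonneg fun _ _ => norm_nonneg _
  refine ⟨c / 2 / (∑ k ∈ a.support, ‖a k‖ + 1), by positivity, fun ν _ hν hcν => ?_⟩
  by_contra! hsmall
  have hnear : ‖∫ x, f x ∂ν - ∑ k ∈ a.support, a k * fhat ν (ξ + intVec k)‖ ≤ c / 2 :=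
    norm_integral_sub_sum_fhat_le (integrable_of_ae_mem_isCompact (isCompact_unitCube t) hν hf) a ξ
      (hν.mono ha)
  have hpoly : ‖∑ k ∈ a.support, a k * fhat ν (ξ + intVec k)‖ < c / 2 := by
    calc ‖∑ k ∈ a.support, a k * fhat ν (ξ + intVec k)‖
        ≤ (∑ k ∈ a.support, ‖a k‖) * (c / 2 / (∑ k ∈ a.support, ‖a k‖ + 1)) := by
          rw [Finset.sum_mul]
          refine norm_sum_le_of_le _ fun k _ => ?_
          rw [norm_mul]
          exact mul_le_mul_of_nonneg_left (hsmall k).le (norm_nonneg _)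
      _ < c / 2 := by rw [mul_div_assoc', div_lt_iff₀ (by positivity)]; nlinarith [hS]
  linarith [norm_le_norm_sub_add (∫ x, f x ∂ν) (∑ k ∈ a.support, a k * fhat ν (ξ + intVec k))]

lemma isEquiPositive_of_le_measureReal {t : E d} {K : Set (E d)} (hK : IsCompact K)
    (hKt : K ⊆ interior (unitCube t)) {c : ℝ} (hc : 0 < c) {Φ : Set (Measure (E d))}
    (hΦ : ∀ ν ∈ Φ, IsProbabilityMeasure ν) (hcube : ∀ ν ∈ Φ, ∀ᵐ x ∂ν, x ∈ unitCube t)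
    (hmass : ∀ ν ∈ Φ, c ≤ ν.real K) : IsEquiPositive Φ := by
  obtain ⟨M, hM⟩ := (isCompact_unitCube t).isBounded.exists_norm_le
  obtain ⟨φ, hφK, hφ0, -, hφ⟩ := exists_continuous_one_zero_of_isCompact hK
    isOpen_interior.isClosed_compl (Set.disjoint_compl_right_iff_subset.2 hKt)
  refine isEquiPositive_of_forall_exists hΦ (fun ν hν => (hcube ν hν).mono hM) fun ξ => ?_
  obtain ⟨ε, hε, h⟩ := exists_pos_forall_le_norm_fhat_of_le_integral (t := t)
    (f := fun x => (φ x : ℂ)) (by fun_prop) (fun _ hx => by simp [hφ0 hx]) hc ξ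
  refine ⟨ε, hε, fun ν hν => h ν (hΦ ν hν) (hcube ν hν) ?_⟩
  have := hΦ ν hν
  have hφν : Integrable φ ν :=
    integrable_of_ae_mem_isCompact (isCompact_unitCube t) (hcube ν hν) φ.continuous
  calc c ≤ ∫ _ in K, (1 : ℝ) ∂ν := by simpa using hmass ν hν
    _ = ∫ x in K, φ x ∂ν := setIntegral_congr_fun hK.measurableSet fun _ hx => (hφK hx).symm
    _ ≤ ∫ x, φ x ∂ν := setIntegral_le_integral hφν (.of_forall fun x => (hφ x).1)
    _ ≤ ‖∫ x, (φ x : ℂ) ∂ν‖ := by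
      rw [integral_complex_ofReal, Complex.norm_real]
      exact le_abs_self _

end MassInsideCube

section InfiniteConvolution

lemma ae_mem_discreteMeasure (A : Finset (E d)) : ∀ᵐ x ∂discreteMeasure A, x ∈ A := by
  refine Measure.ae_smul_measure (ae_finsetSum_measure_iff.2 fun a ha => ?_) _
  simpa [ae_dirac_eq] using ha

lemma discreteMeasure_singleton {A : Finset (E d)} {a : E d} (ha : a ∈ A) :
    discreteMeasure A {a} = (A.card : ENNReal)⁻¹ := by
  classical
  simp [discreteMeasure, Measure.finsetSum_apply, Set.indicator_apply, ha]

lemma map_sum_range_succ_infinitePi (P : ℕ → Measure (E d)) [∀ n, IsProbabilityMeasure (P n)]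
    (n : ℕ) :
    (Measure.infinitePi P).map (fun ω => ∑ k ∈ Finset.range (n + 1), ω k) =
      Measure.conv ((Measure.infinitePi P).map fun ω => ∑ k ∈ Finset.range n, ω k) (P n) := by
  have hind := (ProbabilityTheory.iIndepFun_infinitePi (P := P) (X := fun _ x => x)
    fun _ => measurable_id).indepFun_sum_range_succ measurable_pi_apply n
  rw [Finset.sum_fn] at hind
  simpa only [Finset.sum_range_succ, Pi.add_def, Measure.infinitePi_map_eval] using
    hind.map_add_eq_map_conv_map (by fun_prop) (measurable_pi_apply n)

lemma weaklyConverges_map_of_tendsto_ae {Ω : Type*} [MeasurableSpace Ω] {Q : Measure Ω}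
    [IsProbabilityMeasure Q] {X : ℕ → Ω → E d} {S : Ω → E d} (hX : ∀ n, Measurable (X n))
    (h : ∀ᵐ ω ∂Q, Tendsto (fun n => X n ω) atTop (𝓝 (S ω))) :
    WeaklyConverges (fun n => Q.map (X n)) (Q.map S) :=
  ProbabilityMeasure.tendsto_iff_forall_integral_tendsto.1
    ((tendstoInMeasure_of_tendsto_ae (fun n => (hX n).aestronglyMeasurable) h).tendstoInDistribution
      fun n => (hX n).aemeasurable).tendsto

variable {R : ℕ → Matrix (Fin d) (Fin d) ℤ} {B : ℕ → Finset (Fin d → ℤ)} {t : E d}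

/-- The law of a sequence of independent digits, the `n`-th of which is uniformly distributed on
`(R_n ⋯ R_1)⁻¹ B_n`. The infinite convolution is the law of the sum of the digits. -/
def digitLaw (R : ℕ → Matrix (Fin d) (Fin d) ℤ) (B : ℕ → Finset (Fin d → ℤ)) :
    Measure (ℕ → E d) :=
  Measure.infinitePi fun n => discreteMeasure (invImage (cumProd R (n + 1)) (B n))

/-- The image `∑_{k < n} ω_k + (R_n ⋯ R_1)⁻¹ (t + [0,1]^d)` of the cube under the composition of the
first `n` contractions selected by the digits `ω`. -/
def cylinder (R : ℕ → Matrix (Fin d) (Fin d) ℤ) (t : E d) (ω : ℕ → E d) (n : ℕ) : Set (E d) :=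
  (fun x => ∑ k ∈ Finset.range n, ω k + toMap (cumProd R n)⁻¹ x) '' unitCube t

lemma cylinder_zero (ω : ℕ → E d) : cylinder R t ω 0 = unitCube t := by
  simp [cylinder, cumProd, toMap_one]

lemma cylinder_one {ω : ℕ → E d} {b : Fin d → ℤ}
    (hω : ω 0 = toMap (cumProd R 1)⁻¹ (intVec b)) :
    cylinder R t ω 1 = (fun x => toMap (realMat (R 0))⁻¹ (x + intVec b)) '' unitCube t := by
  simp [cylinder, cumProd, hω, add_comm]

lemma isCompact_cylinder (ω : ℕ → E d) (n : ℕ) : IsCompact (cylinder R t ω n) :=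
  (isCompact_unitCube t).image (by fun_prop)

lemma antitone_cylinder
    (hmaps : ∀ n, ∀ b ∈ B n,
      (fun x => toMap (realMat (R n))⁻¹ (x + intVec b)) '' unitCube t ⊆ unitCube t)
    {ω : ℕ → E d} (hω : ∀ n, ω n ∈ invImage (cumProd R (n + 1)) (B n)) :
    Antitone (cylinder R t ω) := by
  classical
  refine antitone_nat_of_succ_le fun n => ?_
  rintro _ ⟨x, hx, rfl⟩
  obtain ⟨b, hb, hbω⟩ := Finset.mem_image.1 (hω n)
  refine ⟨_, hmaps n b hb ⟨x, hx, rfl⟩, ?_⟩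
  simp only [Finset.sum_range_succ, ← hbω, cumProd, Matrix.mul_inv_rev, toMap_mul, map_add]
  abel

lemma exists_tendsto_sum_digits
    (hlim : Tendsto (fun n => ‖toMap (invProd R n)‖) atTop (𝓝 0))
    (hmaps : ∀ n, ∀ b ∈ B n,
      (fun x => toMap (realMat (R n))⁻¹ (x + intVec b)) '' unitCube t ⊆ unitCube t)
    {ω : ℕ → E d} (hω : ∀ n, ω n ∈ invImage (cumProd R (n + 1)) (B n)) :
    ∃ s, Tendsto (fun n => ∑ k ∈ Finset.range n, ω k) atTop (𝓝 s) ∧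
      ∀ n, s ∈ cylinder R t ω n := by
  obtain ⟨M, hM⟩ := (isCompact_unitCube t).isBounded.exists_norm_le
  obtain ⟨s, hs⟩ := IsCompact.nonempty_iInter_of_sequence_nonempty_isCompact_isClosed
    (cylinder R t ω) (fun n => antitone_cylinder hmaps hω n.le_succ)
    (fun n => ⟨_, t, self_mem_unitCube t, rfl⟩) (isCompact_cylinder ω 0)
    fun n => (isCompact_cylinder ω n).isClosed
  rw [Set.mem_iInter] at hs
  have hle : ∀ n, ‖∑ k ∈ Finset.range n, ω k - s‖ ≤ ‖toMap (invProd R n)‖ * M := by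
    intro n
    obtain ⟨x, hx, hxs⟩ := hs n
    rw [← hxs, sub_add_cancel_left, norm_neg, invProd_eq_inv_cumProd]
    exact (toMap (cumProd R n)⁻¹).le_of_opNorm_le_of_le le_rfl (hM x hx)
  refine ⟨s, tendsto_iff_norm_sub_tendsto_zero.2 ?_, hs⟩
  exact squeeze_zero (fun _ => norm_nonneg _) hle (by simpa using hlim.mul_const M)

lemma isProbabilityMeasure_digits (hB : ∀ n, (B n).Nonempty) (n : ℕ) :
    IsProbabilityMeasure (discreteMeasure (invImage (cumProd R (n + 1)) (B n))) :=
  isProbabilityMeasure_discreteMeasure (invImage_nonempty _ (hB n))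

lemma map_eval_digitLaw (hB : ∀ n, (B n).Nonempty) (n : ℕ) :
    (digitLaw R B).map (fun ω => ω n) = discreteMeasure (invImage (cumProd R (n + 1)) (B n)) :=
  have := isProbabilityMeasure_digits (R := R) hB
  Measure.infinitePi_map_eval _ n

lemma map_sum_digitLaw (hB : ∀ n, (B n).Nonempty) (n : ℕ) :
    (digitLaw R B).map (fun ω => ∑ k ∈ Finset.range n, ω k) = finiteConv R B n := by
  have := isProbabilityMeasure_digits (R := R) hB
  induction n with
  | zero => simp [digitLaw, finiteConv]
  | succ n ih => rw [finiteConv, ← ih, digitLaw, map_sum_range_succ_infinitePi]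

lemma ae_mem_digitLaw (hB : ∀ n, (B n).Nonempty) :
    ∀ᵐ ω ∂digitLaw R B, ∀ n, ω n ∈ invImage (cumProd R (n + 1)) (B n) := by
  refine ae_all_iff.2 fun n => ae_of_ae_map (measurable_pi_apply n).aemeasurable ?_
  rw [map_eval_digitLaw hB]
  exact ae_mem_discreteMeasure _

lemma inv_card_le_digitLaw (hB : ∀ n, (B n).Nonempty) {b : Fin d → ℤ} (hb : b ∈ B 0) :
    ((B 0).card : ENNReal)⁻¹ ≤
      digitLaw R B {ω | ω 0 = toMap (cumProd R 1)⁻¹ (intVec b)} := by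
  classical
  have hmem : toMap (cumProd R 1)⁻¹ (intVec b) ∈ invImage (cumProd R 1) (B 0) :=
    Finset.mem_image_of_mem _ hb
  calc ((B 0).card : ENNReal)⁻¹ ≤ ((invImage (cumProd R 1) (B 0)).card : ENNReal)⁻¹ :=
        ENNReal.inv_le_inv.2 (by exact_mod_cast Finset.card_image_le)
    _ = (digitLaw R B).map (fun ω => ω 0) {toMap (cumProd R 1)⁻¹ (intVec b)} := by
        rw [map_eval_digitLaw hB, discreteMeasure_singleton hmem]
    _ = _ := Measure.map_apply (measurable_pi_apply 0) (measurableSet_singleton _)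

lemma exists_measurable_tendsto_sum_digits (hB : ∀ n, (B n).Nonempty)
    (hlim : Tendsto (fun n => ‖toMap (invProd R n)‖) atTop (𝓝 0))
    (hmaps : ∀ n, ∀ b ∈ B n,
      (fun x => toMap (realMat (R n))⁻¹ (x + intVec b)) '' unitCube t ⊆ unitCube t) :
    ∃ S : (ℕ → E d) → E d, Measurable S ∧ ∀ᵐ ω ∂digitLaw R B,
      Tendsto (fun n => ∑ k ∈ Finset.range n, ω k) atTop (𝓝 (S ω)) ∧
        ∀ n, S ω ∈ cylinder R t ω n := by
  obtain ⟨S, hS, hSlim⟩ := measurable_limit_of_tendsto_metrizable_ae (μ := digitLaw R B)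
    (f := fun n ω => ∑ k ∈ Finset.range n, ω k) (fun n => by fun_prop)
    ((ae_mem_digitLaw hB).mono fun ω hω =>
      (exists_tendsto_sum_digits hlim hmaps hω).imp fun _ hs => hs.1)
  refine ⟨S, hS, ?_⟩
  filter_upwards [ae_mem_digitLaw hB, hSlim] with ω hω hlimω
  obtain ⟨s, hs, hcyl⟩ := exists_tendsto_sum_digits hlim hmaps hω
  obtain rfl := tendsto_nhds_unique hlimω hs
  exact ⟨hs, hcyl⟩

theorem exists_isInfiniteConvolution (hB : ∀ n, (B n).Nonempty)
    (hlim : Tendsto (fun n => ‖toMap (invProd R n)‖) atTop (𝓝 0))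
    (hmaps : ∀ n, ∀ b ∈ B n,
      (fun x => toMap (realMat (R n))⁻¹ (x + intVec b)) '' unitCube t ⊆ unitCube t) :
    ∃ μ : Measure (E d), IsInfiniteConvolution R B μ ∧ (∀ᵐ x ∂μ, x ∈ unitCube t) ∧
      ∀ b ∈ B 0, ((B 0).card : ℝ)⁻¹ ≤
        μ.real ((fun x => toMap (realMat (R 0))⁻¹ (x + intVec b)) '' unitCube t) := by
  have hprob : IsProbabilityMeasure (digitLaw R B) := by
    have := isProbabilityMeasure_digits (R := R) hB
    unfold digitLaw; infer_instance
  obtain ⟨S, hS, hSlim⟩ := exists_measurable_tendsto_sum_digits hB hlim hmaps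
  have hSprob : IsProbabilityMeasure ((digitLaw R B).map S) :=
    Measure.isProbabilityMeasure_map hS.aemeasurable
  refine ⟨(digitLaw R B).map S, ⟨hSprob, ?_⟩, ?_, fun b hb => ?_⟩
  · simpa only [map_sum_digitLaw hB] using weaklyConverges_map_of_tendsto_ae
      (X := fun n ω => ∑ k ∈ Finset.range n, ω k) (fun n => by fun_prop)
      (hSlim.mono fun ω hω => hω.1)
  · refine (ae_map_iff hS.aemeasurable (isCompact_unitCube t).measurableSet).2 ?_
    filter_upwards [hSlim] with ω hω
    exact (cylinder_zero ω).subset (hω.2 0)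
  · have hK : IsCompact ((fun x => toMap (realMat (R 0))⁻¹ (x + intVec b)) '' unitCube t) :=
      (isCompact_unitCube t).image (by fun_prop)
    rw [measureReal_def, Measure.map_apply hS hK.measurableSet, ← ENNReal.toReal_natCast,
      ← ENNReal.toReal_inv]
    refine ENNReal.toReal_mono (measure_ne_top _ _)
      ((inv_card_le_digitLaw hB hb).trans (measure_mono_ae ?_))
    filter_upwards [hSlim] with ω hω hω0
    exact cylinder_one hω0 ▸ hω.2 1

end InfiniteConvolution

section Spectrum

lemma eventually_mem_of_mem_iUnion {α : Type*} {s : ℕ → Finset α} (hs : Monotone s) {a : α}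
    (ha : a ∈ ⋃ j, (s j : Set α)) : ∀ᶠ j in atTop, a ∈ s j := by
  obtain ⟨i, hi⟩ := Set.mem_iUnion.1 ha
  exact (eventually_ge_atTop i).mono fun j hij => hs hij hi

lemma summable_iUnion_of_tendsto_sum {α : Type*} {s : ℕ → Finset α} (hs : Monotone s)
    {f : ℕ → α → ℝ} {g : α → ℝ} {c : ℝ} (hf : ∀ j a, 0 ≤ f j a)
    (hsum : Tendsto (fun j => ∑ a ∈ s j, f j a) atTop (𝓝 c))
    (hlim : ∀ a, Tendsto (fun j => f j a) atTop (𝓝 (g a))) :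
    Summable fun a : ⋃ j, (s j : Set α) => g a := by
  classical
  refine summable_of_sum_le (c := c) (fun a => ge_of_tendsto' (hlim a) fun j => hf j a) fun u => ?_
  refine le_of_tendsto_of_tendsto (tendsto_finsetSum u fun a _ => hlim a) hsum ?_
  have hmem : ∀ᶠ j in atTop, ∀ a ∈ u, (a : α) ∈ s j :=
    (Filter.eventually_all_finset u).2 fun a _ => eventually_mem_of_mem_iUnion hs a.2
  filter_upwards [hmem] with j hj
  rw [← Finset.sum_image Subtype.val_injective.injOn]
  exact Finset.sum_le_sum_of_subset_of_nonneg (Finset.image_subset_iff.2 hj) fun a _ _ => hf j a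

lemma hasSum_iUnion_of_tendsto_sum {α : Type*} {s : ℕ → Finset α} (hs : Monotone s)
    {f : ℕ → α → ℝ} {g : α → ℝ} {c C : ℝ} (hf : ∀ j a, 0 ≤ f j a)
    (hsum : Tendsto (fun j => ∑ a ∈ s j, f j a) atTop (𝓝 c))
    (hlim : ∀ a, Tendsto (fun j => f j a) atTop (𝓝 (g a)))
    (hle : ∀ᶠ j in atTop, ∀ a ∈ s j, f j a ≤ C * g a) :
    HasSum (fun a : ⋃ j, (s j : Set α) => g a) c := by
  have hg : ∀ a, 0 ≤ g a := fun a => ge_of_tendsto' (hlim a) fun j => hf j a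
  have hsummable := summable_iUnion_of_tendsto_sum hs hf hsum hlim
  let F : ℕ → (⋃ j, (s j : Set α) : Set α) → ℝ := fun j a => (s j : Set α).indicator (f j) a
  have htsum : ∀ j, ∑' a, F j a = ∑ a ∈ s j, f j a := by
    intro j
    have hsub : (s j : Set α) ⊆ ⋃ j, (s j : Set α) := Set.subset_iUnion (fun j => (s j : Set α)) j
    rw [tsum_subtype (⋃ j, (s j : Set α)), Set.indicator_indicator,
      Set.inter_eq_self_of_subset_right hsub, ← tsum_subtype, Finset.tsum_subtype']
  have htendsto : Tendsto (fun j => ∑' a, F j a) atTop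
      (𝓝 (∑' a : ⋃ j, (s j : Set α), g a)) := by
    refine tendsto_tsum_of_dominated_convergence (hsummable.mul_left |C|) (fun a => ?_) ?_
    · refine (hlim a).congr' ((eventually_mem_of_mem_iUnion hs a.2).mono fun j hj => ?_)
      exact (Set.indicator_of_mem (Finset.mem_coe.2 hj) _).symm
    · filter_upwards [hle] with j hj a
      refine (norm_indicator_eq_indicator_norm _ _).trans_le
        (Set.indicator_apply_le' (fun ha => ?_) fun _ => mul_nonneg (abs_nonneg C) (hg a))
      rw [Real.norm_of_nonneg (hf j a)]
      exact (hj a ha).trans (mul_le_mul_of_nonneg_right (le_abs_self C) (hg a))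
  simp only [htsum] at htendsto
  exact tendsto_nhds_unique htendsto hsum ▸ hsummable.hasSum

variable {R : ℕ → Matrix (Fin d) (Fin d) ℤ} {B : ℕ → Finset (Fin d → ℤ)} {μ : Measure (E d)}

lemma IsInfiniteConvolution.tendsto_fhat (hμ : IsInfiniteConvolution R B μ)
    (hB : ∀ n, (B n).Nonempty) (ξ : E d) :
    Tendsto (fun n => fhat (finiteConv R B n) ξ) atTop (𝓝 (fhat μ ξ)) := by
  have hprob := isProbabilityMeasure_finiteConv (R := R) hB
  let P : ProbabilityMeasure (E d) := ⟨μ, hμ.1⟩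
  let Pn : ℕ → ProbabilityMeasure (E d) := fun n => ⟨finiteConv R B n, hprob n⟩
  have hweak : Tendsto Pn atTop (𝓝 P) :=
    ProbabilityMeasure.tendsto_iff_forall_integral_tendsto.2 hμ.2
  exact (ProbabilityMeasure.tendsto_iff_forall_integral_rclike_tendsto ℂ).1 hweak
    (.ofNormedAddCommGroup (expo ξ) (continuous_expo ξ) 1 fun x => (norm_expo ξ x).le)

lemma IsInfiniteConvolution.fhat_eq_mul_tail (hμ : IsInfiniteConvolution R B μ)
    (hR : ∀ n, IsUnit (realMat (R n)).det) (hB : ∀ n, (B n).Nonempty) {n : ℕ}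
    {ν : Measure (E d)}
    (hν : IsInfiniteConvolution (fun k => R (n + k)) (fun k => B (n + k)) ν) (ξ : E d) :
    fhat μ ξ = fhat (finiteConv R B n) ξ * fhat ν (dualMap R n ξ) := by
  have hshift : Tendsto (fun m => fhat (finiteConv R B (n + m)) ξ) atTop (𝓝 (fhat μ ξ)) := by
    simpa only [add_comm] using (tendsto_add_atTop_iff_nat n).2 (hμ.tendsto_fhat hB ξ)
  simp only [fhat_finiteConv_add hR] at hshift
  exact tendsto_nhds_unique hshift
    ((hν.tendsto_fhat (fun k => hB (n + k)) (dualMap R n ξ)).const_mul _)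

/-- The tail `ν` of an infinite convolution after `n` factors has a Fourier transform of modulus at
least `ε` on the balls of radius `δ` centred at the images of `Λ` under `dualMap R n`. -/
def IsTailBoundedBelow (R : ℕ → Matrix (Fin d) (Fin d) ℤ) (ν : Measure (E d)) (ε δ : ℝ) (n : ℕ)
    (Λ : Finset (Fin d → ℤ)) : Prop :=
  ∀ l ∈ Λ, ∀ y : E d, ‖y‖ < δ → ε ≤ ‖fhat ν (dualMap R n (intVec l) + y)‖

lemma IsFiniteSpectrum.exists_isTailBoundedBelow (hRB : ∀ n, IsHadamardPair (R n) (B n))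
    (hlim : Tendsto (fun n => ‖toMap (invProd R n)‖) atTop (𝓝 0)) {s : Set ℕ}
    (hs : s.Infinite) {ν : ℕ → Measure (E d)} {ε δ : ℝ} (hδ : 0 < δ)
    (hν : ∀ n ∈ s, ∀ x : E d, ∃ k : Fin d → ℤ, (x = 0 → k = 0) ∧
      ∀ y : E d, ‖y‖ < δ → ε ≤ ‖fhat (ν n) (x + intVec k + y)‖)
    {n : ℕ} {Λ : Finset (Fin d → ℤ)} (h : IsFiniteSpectrum (finiteConv R B n) Λ) :
    ∃ n' ∈ s, n < n' ∧ ∃ Λ', Λ ⊆ Λ' ∧ IsFiniteSpectrum (finiteConv R B n') Λ' ∧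
      IsTailBoundedBelow R (ν n') ε (δ / 2) n' Λ' := by
  classical
  have hR : ∀ n, IsUnit (realMat (R n)).det := fun n => (hRB n).isUnit_det
  have hsmall : ∀ᶠ m in atTop, ∀ l ∈ Λ, ‖dualMap R m (intVec l)‖ < δ / 2 :=
    (Filter.eventually_all_finset Λ).2 fun l _ =>
      (tendsto_zero_iff_norm_tendsto_zero.1 (tendsto_dualMap hlim (intVec l))).eventually_lt_const
        (half_pos hδ)
  obtain ⟨n', hn's, hn'Λ, hn'⟩ := ((Nat.frequently_atTop_iff_infinite.2 hs).and_eventually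
    (hsmall.and (eventually_gt_atTop n))).exists
  obtain ⟨Λ₁, hΛ₁, hspec⟩ := h.exists_of_le hRB hn'.le
  choose k hk0 hk using hν n' hn's
  -- Frequencies of `Λ` are kept, since `dualMap R n'` already brings them close to `0`.
  let κ : (Fin d → ℤ) → Fin d → ℤ := fun l => if l ∈ Λ then 0 else k (dualMap R n' (intVec l))
  refine ⟨n', hn's, hn', _, fun l hl => Finset.mem_image.2 ⟨l, hΛ₁ hl, by simp [κ, hl]⟩,
    hspec.image_add_period hR (fun n => (hRB n).nonempty) κ, ?_⟩
  rintro _ hl y hy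
  obtain ⟨l, -, rfl⟩ := Finset.mem_image.1 hl
  rw [intVec_add, map_add, dualMap_intVec hR]
  by_cases hlΛ : l ∈ Λ
  · have hball : ‖dualMap R n' (intVec l) + y‖ < δ :=
      (norm_add_le _ _).trans_lt (by linarith [hn'Λ l hlΛ])
    simpa [κ, hlΛ, hk0 0 rfl, intVec_zero] using hk 0 _ hball
  · simpa [κ, hlΛ] using hk _ y (hy.trans (half_lt_self hδ))

lemma exists_monotone_isTailBoundedBelow (hRB : ∀ n, IsHadamardPair (R n) (B n))
    (hlim : Tendsto (fun n => ‖toMap (invProd R n)‖) atTop (𝓝 0)) {s : Set ℕ}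
    (hs : s.Infinite) {ν : ℕ → Measure (E d)} (hν : IsEquiPositive (ν '' s)) :
    ∃ ε > 0, ∃ δ > 0, ∃ (N : ℕ → ℕ) (Λ : ℕ → Finset (Fin d → ℤ)), StrictMono N ∧ Monotone Λ ∧
      ∀ j, N j ∈ s ∧ IsFiniteSpectrum (finiteConv R B (N j)) (Λ j) ∧
        IsTailBoundedBelow R (ν (N j)) ε δ (N j) (Λ j) := by
  obtain ⟨ε, hε, δ, hδ, hpos⟩ := hν
  rw [Set.forall_mem_image] at hpos
  choose n hns hlt Λ' hsub hspec hbdd using fun p :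
      {p : ℕ × Finset (Fin d → ℤ) // IsFiniteSpectrum (finiteConv R B p.1) p.2} =>
    p.2.exists_isTailBoundedBelow hRB hlim hs hδ hpos
  let next : {p : ℕ × Finset (Fin d → ℤ) // IsFiniteSpectrum (finiteConv R B p.1) p.2} →
      {p : ℕ × Finset (Fin d → ℤ) // IsFiniteSpectrum (finiteConv R B p.1) p.2} :=
    fun p => ⟨(n p, Λ' p), hspec p⟩
  let u := fun j => next^[j] ⟨(0, {0}), isFiniteSpectrum_zero⟩
  have hu : ∀ j, u (j + 1) = next (u j) := fun j => Function.iterate_succ_apply' _ _ _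
  refine ⟨ε, hε, δ / 2, half_pos hδ, fun j => (u (j + 1)).1.1, fun j => (u (j + 1)).1.2,
    strictMono_nat_of_lt_succ fun j => ?_, monotone_nat_of_le_succ fun j => ?_, fun j => ?_⟩
  · rw [hu (j + 1)]; exact hlt _
  · rw [hu (j + 1)]; exact hsub _
  · simp only [hu j]; exact ⟨hns _, hspec _, hbdd _⟩

lemma IsTailBoundedBelow.norm_fhat_finiteConv_sq_le {ν : Measure (E d)} {ε δ : ℝ} {n : ℕ}
    {Λ : Finset (Fin d → ℤ)} (h : IsTailBoundedBelow R ν ε δ n Λ) (hε : 0 < ε)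
    (hμν : ∀ ξ, fhat μ ξ = fhat (finiteConv R B n) ξ * fhat ν (dualMap R n ξ)) {ξ : E d}
    (hξ : ‖dualMap R n ξ‖ < δ) {l : Fin d → ℤ} (hl : l ∈ Λ) :
    ‖fhat (finiteConv R B n) (ξ + intVec l)‖ ^ 2 ≤
      (ε ^ 2)⁻¹ * ‖fhat μ (ξ + intVec l)‖ ^ 2 := by
  have htail := h l hl _ hξ
  rw [← map_add, add_comm] at htail
  rw [hμν, norm_mul, mul_pow, ← div_eq_inv_mul, le_div_iff₀ (by positivity)]
  gcongr

theorem IsInfiniteConvolution.exists_isSpectrum (hμ : IsInfiniteConvolution R B μ)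
    (hRB : ∀ n, IsHadamardPair (R n) (B n))
    (hlim : Tendsto (fun n => ‖toMap (invProd R n)‖) atTop (𝓝 0)) {s : Set ℕ}
    (hs : s.Infinite) {ν : ℕ → Measure (E d)}
    (hν : ∀ n ∈ s, IsInfiniteConvolution (fun k => R (n + k)) (fun k => B (n + k)) (ν n))
    (hpos : IsEquiPositive (ν '' s)) :
    ∃ Λ : Set (Fin d → ℤ), IsSpectrum μ (intVec '' Λ) := by
  have hB : ∀ n, (B n).Nonempty := fun n => (hRB n).nonempty
  obtain ⟨ε, hε, δ, hδ, N, Λ, hN, hΛ, hNΛ⟩ := exists_monotone_isTailBoundedBelow hRB hlim hs hpos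
  have := hμ.1
  suffices hsum : ∀ ξ, HasSum
      (fun l : ⋃ j, (Λ j : Set (Fin d → ℤ)) => ‖fhat μ (ξ + intVec l)‖ ^ 2) 1 from
    ⟨_, isSpectrum_of_hasSum ((Set.to_countable _).image _) fun ξ =>
      (Equiv.Set.image intVec _ intVec_injective).hasSum_iff.1 (hsum ξ)⟩
  intro ξ
  have hsmall : ∀ᶠ j in atTop, ‖dualMap R (N j) ξ‖ < δ :=
    (tendsto_zero_iff_norm_tendsto_zero.1 ((tendsto_dualMap hlim ξ).comp
      hN.tendsto_atTop)).eventually_lt_const hδ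
  refine hasSum_iUnion_of_tendsto_sum (C := (ε ^ 2)⁻¹) hΛ
    (f := fun j l => ‖fhat (finiteConv R B (N j)) (ξ + intVec l)‖ ^ 2)
    (g := fun l => ‖fhat μ (ξ + intVec l)‖ ^ 2) (fun _ _ => sq_nonneg _)
    (tendsto_const_nhds.congr fun j => ((hNΛ j).2.1 ξ).symm)
    (fun l => (((hμ.tendsto_fhat hB _).comp hN.tendsto_atTop).norm).pow 2) ?_
  filter_upwards [hsmall] with j hj l hl
  exact (hNΛ j).2.2.norm_fhat_finiteConv_sq_le hε
    (hμ.fhat_eq_mul_tail (fun n => (hRB n).isUnit_det) hB (hν _ (hNΛ j).1)) hj hl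

end Spectrum

end SpectralConv

end

theorem theorem1p4_general {d : ℕ} {R : ℕ → Matrix (Fin d) (Fin d) ℤ}
    {B : ℕ → Finset (Fin d → ℤ)} (hRB : ∀ n, IsHadamardPair (R n) (B n))
    (hlim : Tendsto (fun n => ‖toMap (invProd R n)‖) atTop (𝓝 0)) {t₀ : E d}
    (hmaps : ∀ n, ∀ b ∈ B n,
      (fun x => toMap (realMat (R n))⁻¹ (x + intVec b)) '' unitCube t₀ ⊆ unitCube t₀)
    {K : Set (E d)} (hK : IsCompact K) (hKint : K ⊆ interior (unitCube t₀)) {M : ℕ}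
    {S : Set ℕ} (hS : S.Infinite) (hcard : ∀ n ∈ S, (B n).card ≤ M)
    (hint : ∀ n ∈ S, ∃ b ∈ B n,
      (fun x => toMap (realMat (R n))⁻¹ (x + intVec b)) '' unitCube t₀ ⊆ K) :
    ∃ μ : Measure (E d), IsInfiniteConvolution R B μ ∧
      ∃ Λ : Set (E d), Λ ⊆ Set.range (intVec : (Fin d → ℤ) → E d) ∧ IsSpectrum μ Λ := by
  have hB : ∀ n, (B n).Nonempty := fun n => (hRB n).nonempty
  obtain ⟨μ, hμ, -⟩ := exists_isInfiniteConvolution hB hlim hmaps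
  choose ν hν hcube hmass using fun n =>
    exists_isInfiniteConvolution (R := fun k => R (n + k)) (fun k => hB (n + k))
      (tendsto_invProd_shift (fun n => (hRB n).isUnit_det) hlim n) fun k => hmaps (n + k)
  have hmassK : ∀ n ∈ S, (M : ℝ)⁻¹ ≤ (ν n).real K := by
    intro n hn
    obtain ⟨b, hb, hbK⟩ := hint n hn
    have := (hν n).1
    calc (M : ℝ)⁻¹ ≤ ((B n).card : ℝ)⁻¹ :=
          inv_anti₀ (by exact_mod_cast (hB n).card_pos) (by exact_mod_cast hcard n hn)
      _ ≤ _ := hmass n b hb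
      _ ≤ (ν n).real K := measureReal_mono hbK
  obtain ⟨n₀, hn₀⟩ := hS.nonempty
  have hpos := isEquiPositive_of_le_measureReal hK hKint (c := (M : ℝ)⁻¹)
    (inv_pos.2 (by exact_mod_cast (hB n₀).card_pos.trans_le (hcard n₀ hn₀)))
    (Set.forall_mem_image.2 fun n _ => (hν n).1) (Set.forall_mem_image.2 fun n _ => hcube n)
    (Set.forall_mem_image.2 hmassK)
  obtain ⟨Λ, hΛ⟩ := hμ.exists_isSpectrum hRB hlim hS (fun n _ => hν n) hpos
  exact ⟨μ, hμ, _, Set.image_subset_range _ _, hΛ⟩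

theorem theorem1p4 (d : ℕ) (R : ℕ → Matrix (Fin d) (Fin d) ℤ) (B : ℕ → Finset (Fin d → ℤ))
    (hadm : ∀ n, IsAdmissiblePair (R n) (B n))
    (hlim : Tendsto (fun n => ‖toMap (invProd R n)‖) atTop (𝓝 0))
    (t₀ : E d)
    (hmaps : ∀ n, ∀ b ∈ B n,
      (fun x => toMap (realMat (R n))⁻¹ (x + intVec b)) '' unitCube t₀ ⊆ unitCube t₀)
    (hint : ∃ (R' : Matrix (Fin d) (Fin d) ℤ) (B' : Finset (Fin d → ℤ)),
      IsAdmissiblePair R' B' ∧ {n | R n = R' ∧ B n = B'}.Infinite ∧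
      ∃ b₀ ∈ B', (fun x => toMap (realMat R')⁻¹ (x + intVec b₀)) '' unitCube t₀ ⊆
        interior (unitCube t₀)) :
    ∃ μ : Measure (E d), IsInfiniteConvolution R B μ ∧
      ∃ Λ : Set (E d), Λ ⊆ Set.range (intVec : (Fin d → ℤ) → E d) ∧ IsSpectrum μ Λ := by
  obtain ⟨R', B', -, hinf, b₀, hb₀, hb₀int⟩ := hint
  exact theorem1p4_general (fun n => (hadm n).isHadamardPair) hlim hmaps
    ((isCompact_unitCube t₀).image (by fun_prop)) hb₀int hinf (fun n hn => by rw [hn.2])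
    fun n hn => ⟨b₀, hn.2 ▸ hb₀, hn.1 ▸ subset_rfl⟩
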